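/- Let $n\ge 1$ and let $R=R_1\times R_2\times\cdots\times R_n$, where each $R_i$ is a commutative local ring with identity having only finitely many ideals. The following graphs are simple graphs whose vertices are the nonzero proper ideals of $R$; two distinct vertices $I,J$ are adjacent - in the comaximal ideal graph $\mathbb{CG}^*(R)$ iff $I+J=R$; - in the co-annihilating ideal graph $\mathbb{CAG}^*(R)$ iff $\mathrm{Ann}(I)\cap \mathrm{Ann}(J)=(0)$; - in the annihilating ideal graph $\mathbb{AG}^*(R)$ iff $I+J$ is an annihilating ideal, i.e. $r(I+J)=(0)$ for some $r\in R\setminus\{0\}$; - in the intersection graph of ideals $\mathbb{IG}(R)$ iff $I\cap J\neq(0)$. For a graph $G$, let $G^c$ be its complement, $\Delta(G)$ its maximum degree ($0$ for the graph without vertices), $\chi'(G)$ its edge chromatic number and $\chi''(G)$ its total chromatic number (the least number of colors for the vertices and edges such that adjacent vertices, distinct edges with a common end, and a vertex and an edge incident with it receive different colors). $G$ satisfies the Total Coloring Conjecture if $\chi''(G)\in\{\Delta(G)+1,\Delta(G)+2\}$. $G$ is chordal if it has no induced cycle of length at least $4$, and perfect if the chromatic number of each induced subgraph equals its clique number; the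 graph without vertices is chordal and perfect. Then: **(A)** $\mathbb{CG}^*(R)=\mathbb{CAG}^*(R)=\mathbb{AG}^{*c}(R)$, and hence $\mathbb{CG}^{*c}(R)=\mathbb{CAG}^{*c}(R)=\mathbb{AG}^{*}(R)$. Let $G$ denote the graph in (A). **(B)** $G$ is chordal if and only if $n=1$; or $n=2$ and $R_i$ is a field for some $i\in\{1,2\}$; or $n=3$ and $R_i$ is a field for all $i\in\{1,2,3\}$. **(C)** $G^c$ is chordal if and only if $n\le 3$. **(D)** $G$ is perfect if and only if $n\le 4$. **(E)** If $R$ is not a field (that is, if the graphs have at least one vertex), then $G$ and $G^c$ satisfy the Total Coloring Conjecture. Moreover, $\chi'(G)=\Delta(G)$. **(F)** If, moreover, each $R_i$ is a special principal ideal ring (a local Artinian principal ideal ring), then (B), (C), (D) and (E) also hold with $G$ replaced by $\mathbb{IG}^{c}(R)$ (and $G^c$ by $\mathbb{IG}(R)$). -/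

import Mathlib

namespace IdealGraphs

/-! ### Graph theory -/

section Graphs

variable {V : Type*}

/-- The maximum degree `Δ(G)` of a finite graph (equal to `0` for the graph without vertices). -/
noncomputable def maxDeg [Finite V] (G : SimpleGraph V) : ℕ :=
  letI : Fintype V := Fintype.ofFinite V
  letI : DecidableRel G.Adj := Classical.decRel _
  G.maxDegree

/-- A graph is chordal if it has no induced cycle of length at least `4`. -/
def IsChordal (G : SimpleGraph V) : Prop :=
  ∀ k : ℕ, 4 ≤ k → ¬ (SimpleGraph.cycleGraph k).IsIndContained G

/-- A finite graph is perfect if for every induced subgraph the chromatic number equals the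
clique number. -/
def IsPerfect [Finite V] (G : SimpleGraph V) : Prop :=
  ∀ s : Set V, (G.induce s).chromaticNumber = ((G.induce s).cliqueNum : ℕ∞)

/-- The edge chromatic number `χ'(G)`: the least number of colors in a coloring of the edges in
which distinct edges with a common end vertex receive different colors. -/
noncomputable def edgeChromaticNumber (G : SimpleGraph V) : ℕ∞ :=
  G.lineGraph.chromaticNumber

/-- The total graph of `G`: its vertices are the vertices and the edges of `G`, and two of them
are joined if they are adjacent vertices, distinct edges with a common end vertex, or a vertex and
an edge incident with it. -/
def totalGraph (G : SimpleGraph V) : SimpleGraph (V ⊕ G.edgeSet) where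
  Adj
    | .inl v, .inl w => G.Adj v w
    | .inl v, .inr e => v ∈ (e : Sym2 V)
    | .inr e, .inl v => v ∈ (e : Sym2 V)
    | .inr e, .inr f => G.lineGraph.Adj e f
  symm := ⟨by
    rintro (v | e) (w | f) h
    · exact SimpleGraph.Adj.symm h
    · exact h
    · exact h
    · exact SimpleGraph.Adj.symm h⟩
  loopless := ⟨by
    rintro (v | e) h
    · exact G.irrefl h
    · exact G.lineGraph.irrefl h⟩

/-- The total chromatic number `χ''(G)`. -/
noncomputable def totalChromaticNumber (G : SimpleGraph V) : ℕ∞ :=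
  (totalGraph G).chromaticNumber

/-- `G` satisfies the Total Coloring Conjecture: `χ''(G)` is `Δ(G) + 1` or `Δ(G) + 2`. -/
def SatisfiesTCC [Finite V] (G : SimpleGraph V) : Prop :=
  totalChromaticNumber G = ((maxDeg G + 1 : ℕ) : ℕ∞) ∨
    totalChromaticNumber G = ((maxDeg G + 2 : ℕ) : ℕ∞)

end Graphs

/-! ### Graphs on the ideals of a commutative ring -/

section Ideals

/-- The nonzero proper ideals of `R`, the common vertex set of the graphs below. -/
abbrev Vertex (R : Type*) [CommRing R] : Type _ := {I : Ideal R // I ≠ ⊥ ∧ I ≠ ⊤}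

/-- A finite product of rings with finitely many ideals has finitely many ideals. -/
instance finite_ideal_pi {ι : Type*} [Finite ι] (R : ι → Type*) [∀ i, CommRing (R i)]
    [∀ i, Finite (Ideal (R i))] : Finite (Ideal (∀ i, R i)) :=
  Finite.of_equiv _ (Ideal.piOrderIso (R := R)).symm.toEquiv

variable (R : Type*) [CommRing R]

/-- The (modified) comaximal ideal graph `CG*(R)`: `I`, `J` are adjacent iff `I + J = R`. -/
def CG : SimpleGraph (Vertex R) where
  Adj I J := I ≠ J ∧ I.1 ⊔ J.1 = ⊤
  symm := ⟨fun _ _ h => ⟨h.1.symm, by rw [sup_comm]; exact h.2⟩⟩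
  loopless := ⟨fun _ h => h.1 rfl⟩

/-- The co-annihilating ideal graph `CAG*(R)`: distinct `I`, `J` are adjacent iff
`Ann(I) ∩ Ann(J) = 0`. -/
def CAG : SimpleGraph (Vertex R) where
  Adj I J := I ≠ J ∧ I.1.annihilator ⊓ J.1.annihilator = ⊥
  symm := ⟨fun _ _ h => ⟨h.1.symm, by rw [inf_comm]; exact h.2⟩⟩
  loopless := ⟨fun _ h => h.1 rfl⟩

variable {R} in
/-- `I` is an annihilating ideal: it is annihilated by some nonzero element of `R`. -/
def IsAnnihilatingIdeal (I : Ideal R) : Prop :=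
  ∃ r : R, r ≠ 0 ∧ ∀ x ∈ I, r * x = 0

/-- The (modified) annihilating ideal graph `AG*(R)`: distinct `I`, `J` are adjacent iff `I + J`
is an annihilating ideal. -/
def AG : SimpleGraph (Vertex R) where
  Adj I J := I ≠ J ∧ IsAnnihilatingIdeal (I.1 ⊔ J.1)
  symm := ⟨fun _ _ h => ⟨h.1.symm, by rw [sup_comm]; exact h.2⟩⟩
  loopless := ⟨fun _ h => h.1 rfl⟩

/-- The intersection graph of ideals `IG(R)`: distinct `I`, `J` are adjacent iff `I ∩ J ≠ 0`. -/
def IG : SimpleGraph (Vertex R) where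
  Adj I J := I ≠ J ∧ I.1 ⊓ J.1 ≠ ⊥
  symm := ⟨fun _ _ h => ⟨h.1.symm, by rw [inf_comm]; exact h.2⟩⟩
  loopless := ⟨fun _ h => h.1 rfl⟩

end Ideals

end IdealGraphs

/-! An ideal of `R` is a tuple of ideals of the local factors. Since a sum of two ideals of a local
ring is the unit ideal only if one of them is, two tuples are comaximal iff in each coordinate one
of them is the unit ideal. Identify the `q i` ideals of `R i` with `ZMod (q i)` so that the unit
ideal becomes `0`. Then `G` is the graph of disjoint supports on all vectors except `0` and one
vector `p` of full support (`IsSupportModel`). For special principal ideal rings nonzero ideals of a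
factor always meet, so the complement of `IG` has the same model with the zero ideal sent to `0`.
Everything but (A) is proved for the model; the group structure of `ZMod (q i)` is auxiliary and
serves to write colors down. (A) holds because the annihilator of a sum is the intersection of the
annihilators, and every proper ideal is killed by a nonzero element supported in one factor.

Edge coloring. Let `q i₀` be minimal. A vertex supported on `i₀` alone is adjacent to all nonzero
vectors vanishing at `i₀`, so it suffices to use these vectors as colors. Color the edge `a b` by `a
+ b` minus the constant vector given by the representative of its `i₀` coordinate (`shear`). Edges
at a vertex are separated: their sums agree on the support of that vertex, and by minimality of `q
i₀` one common coordinate makes `shear` injective. The only defect is the color `0`, taken when `a +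
b` is constant. It is removed by a shift: if `a` is the constant `s` on a set containing `i₀`, then
for `1 ≤ t ≤ s` its edge to the constant `t` on the complement takes the color belonging to `t - 1`.
The place `t = 0` is free, as the zero vector is no vertex, and the bad edge `t = s` moves away from
`0`.

Total coloring. Now `0` is allowed as a color. Edges get the sheared sums and vertices their own
shears; a conflict between adjacent vertices always involves a vertex that is constant on a support
containing `i₀`. Such vertices are pairwise nonadjacent, so one extra color settles them, for at
most `Δ + 2` colors in all.

For the complement, a vertex of full support is adjacent to everything, and labels in a cyclic group
of order `|V| + 1 = Δ + 2` suffice. If there is none, then every `q i` is `2`, and the vectors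
themselves, in an elementary abelian `2`-group, are labels whose sums along edges avoid `0` and `p`.

Chordality and perfection reduce to small configurations of subsets of at most five points
(`isChordal_of_forall`, `colorable_cliqueNum`). -/

namespace IdealGraphs

/-! ### Edge and total colorings from symmetric functions and group labellings. -/

section Colorings

variable {V C : Type*} {G : SimpleGraph V}

/-- The maximum degree bounds the number of neighbors of each vertex. -/
lemma card_neighborSet_le_maxDeg [Finite V] (v : V) : Nat.card (G.neighborSet v) ≤ maxDeg G := by
  classical
  let _ : Fintype V := Fintype.ofFinite V
  have h := G.degree_le_maxDegree v
  rw [← SimpleGraph.card_neighborSet_eq_degree, ← Nat.card_eq_fintype_card] at h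
  unfold maxDeg
  convert h

/-- The maximum degree is attained. -/
lemma exists_card_neighborSet_eq_maxDeg [Finite V] [Nonempty V] :
    ∃ v, Nat.card (G.neighborSet v) = maxDeg G := by
  classical
  let _ : Fintype V := Fintype.ofFinite V
  obtain ⟨v, h⟩ := G.exists_maximal_degree_vertex
  refine ⟨v, ?_⟩
  rw [← SimpleGraph.card_neighborSet_eq_degree, ← Nat.card_eq_fintype_card] at h
  unfold maxDeg
  rw [← h]

lemma maxDeg_of_isEmpty [Finite V] [IsEmpty V] : maxDeg G = 0 := by
  classical
  let _ : Fintype V := Fintype.ofFinite V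
  unfold maxDeg
  convert G.maxDegree_of_subsingleton

/-- A function on ordered pairs, evaluated at some orientation of an edge. -/
noncomputable def edgeFun (F : V → V → C) (e : G.edgeSet) : C :=
  F (Quot.out (e : Sym2 V)).1 (Quot.out (e : Sym2 V)).2

lemma edgeFun_eq {F : V → V → C} (hF : ∀ v w, F v w = F w v) {e : G.edgeSet} {v w : V}
    (he : (e : Sym2 V) = s(v, w)) : edgeFun F e = F v w := by
  have h : s((Quot.out (e : Sym2 V)).1, (Quot.out (e : Sym2 V)).2) = s(v, w) := by
    rw [← he]; exact Quot.out_eq _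
  unfold edgeFun
  rcases Sym2.eq_iff.1 h with ⟨h₁, h₂⟩ | ⟨h₁, h₂⟩
  · rw [h₁, h₂]
  · rw [h₁, h₂, hF]

/-- A symmetric function which is injective on the edges at each vertex separates
distinct edges with a common end. -/
lemma edgeFun_ne {F : V → V → C} (hF : ∀ v w, F v w = F w v)
    (h : ∀ v w w', G.Adj v w → G.Adj v w' → F v w = F v w' → w = w') {e f : G.edgeSet}
    (hef : G.lineGraph.Adj e f) : edgeFun F e ≠ edgeFun F f := by
  rw [SimpleGraph.lineGraph_adj_iff_exists] at hef
  obtain ⟨hne, v, he, hf⟩ := hef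
  obtain ⟨w, hw⟩ := Sym2.mem_iff_exists.1 he
  obtain ⟨w', hw'⟩ := Sym2.mem_iff_exists.1 hf
  rw [edgeFun_eq hF hw, edgeFun_eq hF hw']
  intro heq
  apply hne
  apply Subtype.ext
  rw [hw, hw', h v w w' _ _ heq]
  · have := e.2; rwa [hw] at this
  · have := f.2; rwa [hw'] at this

lemma edgeFun_mem {F : V → V → C} {P : Set C} (h : ∀ v w, G.Adj v w → F v w ∈ P)
    (e : G.edgeSet) : edgeFun F e ∈ P := by
  apply h
  have h' : s((Quot.out (e : Sym2 V)).1, (Quot.out (e : Sym2 V)).2) = e := Quot.out_eq _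
  rw [← SimpleGraph.mem_edgeSet, h']
  exact e.2

/-- Proper edge colorings from symmetric functions. -/
lemma lineGraph_colorable (P : Set C) [Finite P] (F : V → V → C) (hF : ∀ v w, F v w = F w v)
    (hP : ∀ v w, G.Adj v w → F v w ∈ P)
    (h : ∀ v w w', G.Adj v w → G.Adj v w' → F v w = F v w' → w = w') :
    G.lineGraph.Colorable (Nat.card P) := by
  have := Fintype.ofFinite P
  rw [Nat.card_eq_fintype_card]
  refine SimpleGraph.Coloring.colorable
    (SimpleGraph.Coloring.mk (fun e => (⟨edgeFun F e, edgeFun_mem hP e⟩ : P)) ?_)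
  intro e f hef heq
  exact edgeFun_ne hF h hef (congrArg Subtype.val heq)

/-- Total colorings from symmetric functions. -/
lemma totalGraph_colorable (P : Set C) [Finite P] (c : V → C) (F : V → V → C)
    (hF : ∀ v w, F v w = F w v) (hc : ∀ v, c v ∈ P) (hP : ∀ v w, G.Adj v w → F v w ∈ P)
    (hcc : ∀ v w, G.Adj v w → c v ≠ c w) (hcF : ∀ v w, G.Adj v w → c v ≠ F v w)
    (h : ∀ v w w', G.Adj v w → G.Adj v w' → F v w = F v w' → w = w') :
    (totalGraph G).Colorable (Nat.card P) := by
  have := Fintype.ofFinite P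
  rw [Nat.card_eq_fintype_card]
  have key : ∀ (v : V) (e : G.edgeSet), v ∈ (e : Sym2 V) → c v ≠ edgeFun F e := by
    intro v e hv
    obtain ⟨w, hw⟩ := Sym2.mem_iff_exists.1 hv
    rw [edgeFun_eq hF hw]
    apply hcF
    have := e.2; rwa [hw] at this
  refine SimpleGraph.Coloring.colorable (SimpleGraph.Coloring.mk
    (Sum.elim (fun v => (⟨c v, hc v⟩ : P)) (fun e => ⟨edgeFun F e, edgeFun_mem hP e⟩)) ?_)
  rintro (v | e) (w | f) hadj heq
  · exact hcc v w hadj (congrArg Subtype.val heq)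
  · exact key v f hadj (congrArg Subtype.val heq)
  · exact key w e hadj (congrArg Subtype.val heq).symm
  · exact edgeFun_ne hF h hadj (congrArg Subtype.val heq)

lemma maxDeg_le_of_lineGraph_colorable [Finite V] {k : ℕ} (h : G.lineGraph.Colorable k) :
    maxDeg G ≤ k := by
  rcases isEmpty_or_nonempty V with hV | hV
  · simp [maxDeg_of_isEmpty]
  obtain ⟨v, hv⟩ := exists_card_neighborSet_eq_maxDeg (G := G)
  obtain ⟨c⟩ := h
  rw [← hv, ← Nat.card_fin k]
  refine Nat.card_le_card_of_injective
    (fun w : G.neighborSet v => c ⟨s(v, w.1), w.2⟩) ?_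
  intro w w' heq
  by_contra hne
  refine c.valid (v := ⟨s(v, w.1), w.2⟩) (w := ⟨s(v, w'.1), w'.2⟩) ?_ heq
  rw [SimpleGraph.lineGraph_adj_iff_exists]
  refine ⟨fun h => hne ?_, v, by simp, by simp⟩
  have := congrArg Subtype.val h
  exact Subtype.ext (Sym2.congr_right.1 this)

lemma maxDeg_lt_of_totalGraph_colorable [Finite V] [Nonempty V] {k : ℕ}
    (h : (totalGraph G).Colorable k) : maxDeg G + 1 ≤ k := by
  obtain ⟨v, hv⟩ := exists_card_neighborSet_eq_maxDeg (G := G)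
  obtain ⟨c⟩ := h
  rw [← hv, ← Finite.card_option, ← Nat.card_fin k]
  refine Nat.card_le_card_of_injective (fun w : Option (G.neighborSet v) =>
    w.elim (c (.inl v)) (fun w => c (.inr ⟨s(v, w.1), w.2⟩))) ?_
  have hve : ∀ w : G.neighborSet v, c (.inl v) ≠ c (.inr ⟨s(v, w.1), w.2⟩) := fun w =>
    c.valid (show v ∈ s(v, w.1) by simp)
  rintro (_ | w) (_ | w') heq
  · rfl
  · exact absurd heq (hve w')
  · exact absurd heq.symm (hve w)
  · by_contra hne
    refine c.valid (v := .inr ⟨s(v, w.1), w.2⟩) (w := .inr ⟨s(v, w'.1), w'.2⟩) ?_ heq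
    show G.lineGraph.Adj _ _
    rw [SimpleGraph.lineGraph_adj_iff_exists]
    refine ⟨fun h => hne ?_, v, by simp, by simp⟩
    have := congrArg Subtype.val h
    exact congrArg some (Subtype.ext (Sym2.congr_right.1 this))

lemma edgeChromaticNumber_eq_maxDeg [Finite V] (h : G.lineGraph.Colorable (maxDeg G)) :
    edgeChromaticNumber G = (maxDeg G : ℕ∞) := by
  refine le_antisymm (SimpleGraph.chromaticNumber_le_iff_colorable.2 h) ?_
  rw [edgeChromaticNumber, SimpleGraph.le_chromaticNumber_iff_colorable]
  intro m hm
  exact_mod_cast maxDeg_le_of_lineGraph_colorable hm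

lemma satisfiesTCC_of_colorable [Finite V] [Nonempty V]
    (h : (totalGraph G).Colorable (maxDeg G + 2)) : SatisfiesTCC G := by
  have h₁ : ((maxDeg G + 1 : ℕ) : ℕ∞) ≤ totalChromaticNumber G := by
    rw [totalChromaticNumber, SimpleGraph.le_chromaticNumber_iff_colorable]
    intro m hm
    exact_mod_cast maxDeg_lt_of_totalGraph_colorable hm
  have h₂ : totalChromaticNumber G ≤ ((maxDeg G + 2 : ℕ) : ℕ∞) :=
    SimpleGraph.chromaticNumber_le_iff_colorable.2 h
  obtain ⟨k, hk⟩ := ENat.ne_top_iff_exists.1 (ne_top_of_le_ne_top (ENat.natCast_ne_top _) h₂)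
  unfold SatisfiesTCC
  rw [← hk] at h₁ h₂ ⊢
  norm_cast at h₁ h₂ ⊢
  omega

/-- An injective labelling of the vertices by nonzero elements of an abelian group yields a total
coloring with the labels of the vertices and the sums of the labels of adjacent vertices. -/
lemma totalGraph_colorable_of_labelling {H : Type*} [AddCommGroup H] (P : Set H) [Finite P]
    (f : V → H) (hf : Function.Injective f) (h₀ : ∀ v, f v ≠ 0) (hP : ∀ v, f v ∈ P)
    (hP' : ∀ v w, G.Adj v w → f v + f w ∈ P) : (totalGraph G).Colorable (Nat.card P) := by
  refine totalGraph_colorable P f (fun v w => f v + f w) (fun v w => add_comm _ _) hP hP'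
    (fun v w hvw h => hvw.ne (hf h)) (fun v w hvw h => h₀ w ?_)
    (fun v w w' _ _ h => hf (add_left_cancel h))
  simpa using h

/-- A graph in which some vertex is adjacent to all the others has a total coloring with
`Δ + 2` colors. -/
lemma totalGraph_colorable_of_universal [Finite V] (v : V) (hv : ∀ w, w ≠ v → G.Adj v w) :
    (totalGraph G).Colorable (maxDeg G + 2) := by
  have hdeg : Nat.card V ≤ maxDeg G + 1 := by
    have h := card_neighborSet_le_maxDeg (G := G) v
    have : Nat.card V ≤ Nat.card (Option (G.neighborSet v)) := by
      classical
      refine Nat.card_le_card_of_injective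
        (fun w => if h : w = v then none else some ⟨w, hv w h⟩) ?_
      intro w w' heq
      by_cases h₁ : w = v <;> by_cases h₂ : w' = v <;>
        simp [h₁, h₂] at heq ⊢
      exact congrArg Subtype.val heq
    rw [Finite.card_option] at this
    omega
  let e : V ≃ Fin (Nat.card V) := Finite.equivFin V
  let f : V → ZMod (Nat.card V + 1) := fun w => (((e w : ℕ) + 1 : ℕ) : ZMod (Nat.card V + 1))
  have hcol : (totalGraph G).Colorable (Nat.card (Set.univ : Set (ZMod (Nat.card V + 1)))) := by
    -- The labels are `1, …, |V|`, nonzero and distinct modulo `|V| + 1`.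
    refine totalGraph_colorable_of_labelling _ f ?_ ?_ (fun _ => trivial) (fun _ _ _ => trivial)
    · intro w w' h
      have h' := (ZMod.natCast_eq_natCast_iff' _ _ _).1 h
      rw [Nat.mod_eq_of_lt (by omega), Nat.mod_eq_of_lt (by omega)] at h'
      exact e.injective (Fin.ext (by omega))
    · intro w h
      rw [ZMod.natCast_eq_zero_iff] at h
      have := Nat.le_of_dvd (by omega) h
      omega
  refine hcol.mono ?_
  rw [Nat.card_congr (Equiv.Set.univ _), Nat.card_zmod]
  omega

end Colorings

end IdealGraphs
namespace IdealGraphs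

/-! ### The colors of the edges: sheared sums and their correction. -/

section Shear

variable {ι : Type*} {q : ι → ℕ} [∀ i, NeZero (q i)] {i₀ : ι}

/-- Subtract from every coordinate of a vector the representative of the coordinate `i₀`. -/
def shear (i₀ : ι) (z : ∀ i, ZMod (q i)) : ∀ i, ZMod (q i) :=
  fun j => z j - ((z i₀).val : ZMod (q j))

omit [∀ i, NeZero (q i)] in
lemma shear_apply_self [NeZero (q i₀)] (z : ∀ i, ZMod (q i)) : shear i₀ z i₀ = 0 := by
  simp [shear]

lemma natCast_inj_of_lt {m a b : ℕ} (ha : a < m) (hb : b < m) (h : (a : ZMod m) = b) : a = b := by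
  have h' := (ZMod.natCast_eq_natCast_iff' _ _ _).1 h
  rwa [Nat.mod_eq_of_lt ha, Nat.mod_eq_of_lt hb] at h'

lemma val_lt_of_le (hmin : ∀ i, q i₀ ≤ q i) (a : ∀ i, ZMod (q i)) (i : ι) :
    (a i₀).val < q i := (ZMod.val_lt (a i₀)).trans_le (hmin i)

/-- At the common coordinate `i`, equal shears force the two subtracted representatives to be
congruent modulo `q i`. Both are less than `q i₀ ≤ q i`, so they are equal and can be added back
everywhere. This is the only reason for taking `q i₀` minimal here. -/
lemma eq_of_shear_eq (hmin : ∀ i, q i₀ ≤ q i) {z z' : ∀ i, ZMod (q i)} {i : ι}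
    (hi : z i = z' i) (h : shear i₀ z = shear i₀ z') : z = z' := by
  have h₁ : ((z i₀).val : ZMod (q i)) = (z' i₀).val := by
    have := congrFun h i
    simp only [shear, hi] at this
    exact sub_right_injective this
  have h₂ := natCast_inj_of_lt (val_lt_of_le hmin z i) (val_lt_of_le hmin z' i) h₁
  funext j
  have := congrFun h j
  simp only [shear, h₂] at this
  exact sub_left_injective this

/-- The supports of two vectors are disjoint. -/
def DisjSupp (a b : ∀ i, ZMod (q i)) : Prop := ∀ i, a i = 0 ∨ b i = 0

omit [∀ i, NeZero (q i)] in
lemma DisjSupp.symm {a b : ∀ i, ZMod (q i)} (h : DisjSupp a b) : DisjSupp b a :=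
  fun i => (h i).symm

omit [∀ i, NeZero (q i)] in
lemma exists_apply_ne_zero {a : ∀ i, ZMod (q i)} (h : a ≠ 0) : ∃ i, a i ≠ 0 :=
  Function.ne_iff.1 h

/-- Sums with a common nonzero summand of disjoint support are separated by `shear`. -/
lemma eq_of_shear_add_eq (hmin : ∀ i, q i₀ ≤ q i) {a b b' : ∀ i, ZMod (q i)} (ha : a ≠ 0)
    (hb : DisjSupp a b) (hb' : DisjSupp a b') (h : shear i₀ (a + b) = shear i₀ (a + b')) :
    b = b' := by
  obtain ⟨i, hi⟩ := exists_apply_ne_zero ha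
  refine add_left_cancel (eq_of_shear_eq hmin (i := i) ?_ h)
  simp [(hb i).resolve_left hi, (hb' i).resolve_left hi]

omit [∀ i, NeZero (q i)] in
lemma shear_of_apply_eq_zero {a : ∀ i, ZMod (q i)} (h : a i₀ = 0) : shear i₀ a = a := by
  funext j; simp [shear, h]

/-! #### Total coloring -/

/-- All nonzero coordinates of `a` agree with the nonzero coordinate `i₀`. -/
def IsConst (i₀ : ι) (a : ∀ i, ZMod (q i)) : Prop :=
  a i₀ ≠ 0 ∧ ∀ j, a j = 0 ∨ a j = ((a i₀).val : ZMod (q j))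

omit [∀ i, NeZero (q i)] in
-- At most one of the two vectors is nonzero at `i₀`; the other is its own shear. Wherever the
-- latter vanishes, the former must be `0` or cancel against the subtracted constant.
lemma isConst_of_shear_eq {a b : ∀ i, ZMod (q i)} (ha : a ≠ 0) (hab : DisjSupp a b)
    (h : shear i₀ a = shear i₀ b) : IsConst i₀ a ∨ IsConst i₀ b := by
  wlog hb : b i₀ = 0 generalizing a b
  · have ha₀ := (hab i₀).resolve_right hb
    have hb' : b ≠ 0 := fun h => hb (by simp [h])
    exact (this hb' hab.symm h.symm ha₀).symm
  rw [shear_of_apply_eq_zero hb] at h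
  by_cases ha₀ : a i₀ = 0
  · rw [shear_of_apply_eq_zero ha₀] at h
    subst h
    exact absurd (funext fun i => (hab i).elim id id) ha
  · refine Or.inl ⟨ha₀, fun j => (hab j).imp id fun hj => ?_⟩
    have := congrFun h j
    rw [hj, shear, sub_eq_zero] at this
    exact this

/-! #### Edge coloring -/

/-- `a` is the constant `s = a i₀` on a set containing `i₀`, and `b` is a constant `t` with
`1 ≤ t ≤ s` on the complement. -/
def Special (i₀ : ι) (a b : ∀ i, ZMod (q i)) : Prop :=
  ∃ t : ℕ, 1 ≤ t ∧ t ≤ (a i₀).val ∧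
    ∀ j, (a j = ((a i₀).val : ZMod (q j)) ∧ b j = 0) ∨ (a j = 0 ∧ b j = (t : ZMod (q j)))

/-- The indicator function of the support. -/
noncomputable def ind (b : ∀ i, ZMod (q i)) : ∀ i, ZMod (q i) :=
  open Classical in fun j => if b j = 0 then 0 else 1

/-- The color of an edge with ends `a` and `b`. -/
noncomputable def edgeColor (i₀ : ι) (a b : ∀ i, ZMod (q i)) : ∀ i, ZMod (q i) :=
  open Classical in shear i₀ (a + b) - (if Special i₀ a b then ind b else 0) -
    (if Special i₀ b a then ind a else 0)

omit [∀ i, NeZero (q i)] in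
lemma edgeColor_comm (a b : ∀ i, ZMod (q i)) : edgeColor i₀ a b = edgeColor i₀ b a := by
  unfold edgeColor
  rw [add_comm a b, sub_right_comm]

omit [∀ i, NeZero (q i)] in
lemma Special.left_ne_zero {a b : ∀ i, ZMod (q i)} (h : Special i₀ a b) : a i₀ ≠ 0 := by
  obtain ⟨t, h₁, h₂, -⟩ := h
  intro h
  rw [h, ZMod.val_zero] at h₂
  omega

omit [∀ i, NeZero (q i)] in
lemma Special.right_eq_zero {a b : ∀ i, ZMod (q i)} (h : Special i₀ a b) : b i₀ = 0 := by
  have h₀ := h.left_ne_zero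
  obtain ⟨t, h₁, h₂, h⟩ := h
  exact ((h i₀).resolve_right fun h' => h₀ h'.1).2

omit [∀ i, NeZero (q i)] in
lemma Special.not_symm {a b : ∀ i, ZMod (q i)} (h : Special i₀ a b) : ¬ Special i₀ b a :=
  fun h' => h'.left_ne_zero h.right_eq_zero

omit [∀ i, NeZero (q i)] in
lemma ind_apply_of_eq_zero {b : ∀ i, ZMod (q i)} {j : ι} (h : b j = 0) : ind b j = 0 := by
  simp [ind, h]

omit [∀ i, NeZero (q i)] in
lemma ind_apply_of_ne_zero {b : ∀ i, ZMod (q i)} {j : ι} (h : b j ≠ 0) : ind b j = 1 := by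
  simp [ind, h]

omit [∀ i, NeZero (q i)] in
/-- An edge is colored as if the end avoiding `i₀` were decreased by `1`, if it is special. -/
lemma edgeColor_of_special {a b : ∀ i, ZMod (q i)} (h : Special i₀ a b) :
    edgeColor i₀ a b = shear i₀ (a + (b - ind b)) := by
  have h₀ := h.right_eq_zero
  funext j
  simp only [edgeColor, h, h.not_symm, if_true, if_false, sub_zero, shear, Pi.add_apply,
    Pi.sub_apply, Pi.zero_apply, h₀, ind_apply_of_eq_zero]
  ring

omit [∀ i, NeZero (q i)] in
lemma edgeColor_of_not_special {a b : ∀ i, ZMod (q i)} (h : ¬ Special i₀ a b)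
    (h' : ¬ Special i₀ b a) : edgeColor i₀ a b = shear i₀ (a + b) := by
  simp [edgeColor, h, h']

lemma edgeColor_apply_self (a b : ∀ i, ZMod (q i)) : edgeColor i₀ a b i₀ = 0 := by
  by_cases h : Special i₀ a b
  · rw [edgeColor_of_special h, shear_apply_self]
  by_cases h' : Special i₀ b a
  · rw [edgeColor_comm, edgeColor_of_special h', shear_apply_self]
  rw [edgeColor_of_not_special h h', shear_apply_self]

omit [∀ i, NeZero (q i)] in
lemma DisjSupp.sub_ind {a b : ∀ i, ZMod (q i)} (h : DisjSupp a b) : DisjSupp a (b - ind b) :=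
  fun i => (h i).imp id fun hi => by simp [hi, ind_apply_of_eq_zero hi]

section

variable (hmin : ∀ i, q i₀ ≤ q i)
include hmin

/-- The nonzero values in the definition of a special pair are nonzero. -/
lemma natCast_ne_zero_of_le_val {a : ∀ i, ZMod (q i)} {t : ℕ} (ht : 1 ≤ t)
    (ht' : t ≤ (a i₀).val) (j : ι) : (t : ZMod (q j)) ≠ 0 := by
  have := val_lt_of_le hmin a j
  intro h
  have := natCast_inj_of_lt (m := q j) (a := t) (b := 0) (by omega) (by omega) (by simpa using h)
  omega

/-- A special pair, with the support of `b` as the dividing line. -/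
lemma Special.exists_eq {a b : ∀ i, ZMod (q i)} (h : Special i₀ a b) :
    ∃ t : ℕ, 1 ≤ t ∧ t ≤ (a i₀).val ∧
      (∀ j, b j = 0 → a j = ((a i₀).val : ZMod (q j)) ∧ a j ≠ 0) ∧
      (∀ j, b j ≠ 0 → a j = 0 ∧ b j = (t : ZMod (q j))) := by
  obtain ⟨t, h₁, h₂, h₃⟩ := h
  refine ⟨t, h₁, h₂, fun j hj => ?_, fun j hj => ?_⟩
  · have := natCast_ne_zero_of_le_val hmin h₁ h₂ j
    rcases h₃ j with h | h
    · refine ⟨h.1, ?_⟩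
      rw [h.1]
      exact natCast_ne_zero_of_le_val hmin (h₁.trans h₂) le_rfl j
    · exact absurd (h.2.symm.trans hj) this
  · exact (h₃ j).resolve_left fun h => hj h.2

/-- If `b - 1` on the support of `b` is a nonzero vector, then it is still special. -/
lemma Special.sub_ind {a b : ∀ i, ZMod (q i)} (h : Special i₀ a b) (h₀ : b - ind b ≠ 0) :
    Special i₀ a (b - ind b) := by
  obtain ⟨t, h₁, h₂, h₃, h₄⟩ := h.exists_eq hmin
  have hval : ∀ j, b j ≠ 0 → (b - ind b) j = ((t - 1 : ℕ) : ZMod (q j)) := by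
    intro j hj
    rw [Pi.sub_apply, ind_apply_of_ne_zero hj, (h₄ j hj).2, Nat.cast_sub h₁, Nat.cast_one]
  refine ⟨t - 1, ?_, by omega, fun j => ?_⟩
  · by_contra hlt
    apply h₀
    funext j
    by_cases hj : b j = 0
    · simp [hj, ind_apply_of_eq_zero hj]
    · rw [hval j hj, Nat.lt_one_iff.1 (not_le.1 hlt)]; simp
  · by_cases hj : b j = 0
    · exact Or.inl ⟨(h₃ j hj).1, by simp [hj, ind_apply_of_eq_zero hj]⟩
    · exact Or.inr ⟨(h₄ j hj).1, hval j hj⟩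

/-- In a special pair the support of `b` is the complement of that of `a`, so `a` alone determines
`ind b`. -/
lemma Special.right_inj {a b b' : ∀ i, ZMod (q i)} (h : Special i₀ a b) (h' : Special i₀ a b')
    (heq : b - ind b = b' - ind b') : b = b' := by
  obtain ⟨t, h₁, h₂, h₃, h₄⟩ := h.exists_eq hmin
  obtain ⟨t', h₁', h₂', h₃', h₄'⟩ := h'.exists_eq hmin
  have hsupp : ∀ j, b j = 0 ↔ b' j = 0 := fun j =>
    ⟨fun hj => not_not.1 fun hj' => (h₃ j hj).2 (h₄' j hj').1,
      fun hj => not_not.1 fun hj' => (h₃' j hj).2 (h₄ j hj').1⟩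
  have hind : ind b = ind b' := by
    funext j
    by_cases hj : b j = 0
    · rw [ind_apply_of_eq_zero hj, ind_apply_of_eq_zero ((hsupp j).1 hj)]
    · rw [ind_apply_of_ne_zero hj, ind_apply_of_ne_zero (mt (hsupp j).2 hj)]
  rw [hind] at heq
  exact sub_left_injective heq

/-- The edges at a vertex `a` with nonzero coordinate `i₀` receive distinct colors. -/
lemma edgeColor_inj_of_ne_zero {a b b' : ∀ i, ZMod (q i)} (ha : a i₀ ≠ 0) (hb₀ : b ≠ 0)
    (hb₀' : b' ≠ 0) (hb : DisjSupp a b) (hb' : DisjSupp a b')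
    (h : edgeColor i₀ a b = edgeColor i₀ a b') : b = b' := by
  have ha₀ : a ≠ 0 := fun h => ha (by simp [h])
  have hs : ¬ Special i₀ b a := fun h => ha h.right_eq_zero
  have hs' : ¬ Special i₀ b' a := fun h => ha h.right_eq_zero
  by_cases h₁ : Special i₀ a b <;> by_cases h₂ : Special i₀ a b'
  · rw [edgeColor_of_special h₁, edgeColor_of_special h₂] at h
    exact h₁.right_inj hmin h₂ (eq_of_shear_add_eq hmin ha₀ hb.sub_ind hb'.sub_ind h)
  -- A special edge that took over the color of `a b'` would give `b' = b - ind b`. This is nonzero,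
  -- so `b'` itself forms a special pair with `a`: the shift only moves along special edges.
  · rw [edgeColor_of_special h₁, edgeColor_of_not_special h₂ hs'] at h
    have := eq_of_shear_add_eq hmin ha₀ hb.sub_ind hb' h
    exact absurd (this ▸ h₁.sub_ind hmin (this.symm ▸ hb₀')) h₂
  · rw [edgeColor_of_not_special h₁ hs, edgeColor_of_special h₂] at h
    have := eq_of_shear_add_eq hmin ha₀ hb hb'.sub_ind h
    exact absurd (this.symm ▸ h₂.sub_ind hmin (this ▸ hb₀)) h₁
  · rw [edgeColor_of_not_special h₁ hs, edgeColor_of_not_special h₂ hs'] at h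
    exact eq_of_shear_add_eq hmin ha₀ hb hb' h

/-- A special edge `a b` and an edge `a b'` which is not special have distinct colors. -/
lemma edgeColor_ne_of_special {a b b' : ∀ i, ZMod (q i)} (ha₀ : a ≠ 0) (hb₀' : b' ≠ 0)
    (hb' : DisjSupp a b') (h₁ : Special i₀ b a) (h₂ : ¬ Special i₀ b' a) :
    shear i₀ (b + (a - ind a)) ≠ shear i₀ (b' + a) := by
  intro h
  have ha : a i₀ = 0 := h₁.right_eq_zero
  obtain ⟨t, ht₁, ht₂, h₃, h₄⟩ := h₁.exists_eq hmin
  have hlt := val_lt_of_le hmin b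
  have hlt' := val_lt_of_le hmin b'
  have hself : (b + (a - ind a)) i₀ = b i₀ := by simp [ha, ind_apply_of_eq_zero ha]
  have hself' : (b' + a) i₀ = b' i₀ := by simp [ha]
  -- Write `s` for the value of `b` and `t` for that of `a`. Equality of colors makes `b'` constant
  -- off the support of `a`, with the value `s + 1` by the comparison on that support.
  have hout : ∀ j, a j = 0 → b' j = ((b' i₀).val : ZMod (q j)) := by
    intro j hj
    have := congrFun h j
    simp only [shear, hself, hself'] at this
    simp only [Pi.add_apply, Pi.sub_apply, hj, ind_apply_of_eq_zero hj, (h₃ j hj).1] at this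
    simp only [add_zero, sub_self] at this
    exact sub_eq_zero.1 this.symm
  have hin : ∀ j, a j ≠ 0 → (((b i₀).val + 1 : ℕ) : ZMod (q j)) = ((b' i₀).val : ZMod (q j)) := by
    intro j hj
    have := congrFun h j
    simp only [shear, hself, hself'] at this
    simp only [Pi.add_apply, Pi.sub_apply, ind_apply_of_ne_zero hj, (h₄ j hj).1,
      (hb' j).resolve_left hj] at this
    push_cast
    linear_combination -this
  obtain ⟨j, hj⟩ := exists_apply_ne_zero ha₀
  by_cases h0 : b' i₀ = 0
  · apply hb₀'
    funext k
    by_cases hk : a k = 0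
    · rw [hout k hk, h0]; simp
    · exact (hb' k).resolve_left hk
  · have hpos : (b' i₀).val ≠ 0 := by rwa [Ne, ZMod.val_eq_zero]
    have hval : (b i₀).val + 1 = (b' i₀).val := by
      have h5 := (ZMod.natCast_eq_natCast_iff' _ _ _).1 (hin j hj)
      rw [Nat.mod_eq_of_lt (hlt' j)] at h5
      -- As `s < q j`, the residue of `s + 1` could differ from `s + 1` only by becoming `0`, which
      -- is excluded.
      rcases (show (b i₀).val + 1 ≤ q j from hlt j).lt_or_eq with h6 | h6
      · rwa [Nat.mod_eq_of_lt h6] at h5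
      · rw [h6, Nat.mod_self] at h5
        exact absurd h5.symm hpos
    -- The pair with constants `s + 1` and `t` is again special, since `t ≤ s`.
    refine h₂ ⟨t, ht₁, by omega, fun k => ?_⟩
    by_cases hk : a k = 0
    · exact Or.inl ⟨hout k hk, hk⟩
    · exact Or.inr ⟨(hb' k).resolve_left hk, (h₄ k hk).2⟩

/-- The edges at each vertex receive distinct colors. -/
lemma edgeColor_inj {a b b' : ∀ i, ZMod (q i)} (ha₀ : a ≠ 0) (hb₀ : b ≠ 0)
    (hb₀' : b' ≠ 0) (hb : DisjSupp a b) (hb' : DisjSupp a b')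
    (h : edgeColor i₀ a b = edgeColor i₀ a b') : b = b' := by
  by_cases ha : a i₀ = 0
  swap
  · exact edgeColor_inj_of_ne_zero hmin ha hb₀ hb₀' hb hb' h
  rw [edgeColor_comm a b, edgeColor_comm a b'] at h
  have hs : ¬ Special i₀ a b := fun h => h.left_ne_zero ha
  have hs' : ¬ Special i₀ a b' := fun h => h.left_ne_zero ha
  by_cases h₁ : Special i₀ b a <;> by_cases h₂ : Special i₀ b' a
  · rw [edgeColor_of_special h₁, edgeColor_of_special h₂] at h
    obtain ⟨i, hi⟩ := exists_apply_ne_zero ha₀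
    refine add_right_cancel (eq_of_shear_eq hmin (i := i) ?_ h)
    simp [(hb i).resolve_left hi, (hb' i).resolve_left hi]
  · rw [edgeColor_of_special h₁, edgeColor_of_not_special h₂ hs'] at h
    exact absurd h (edgeColor_ne_of_special hmin ha₀ hb₀' hb' h₁ h₂)
  · rw [edgeColor_of_not_special h₁ hs, edgeColor_of_special h₂] at h
    exact absurd h.symm (edgeColor_ne_of_special hmin ha₀ hb₀ hb h₂ h₁)
  · rw [edgeColor_of_not_special h₁ hs, edgeColor_of_not_special h₂ hs', add_comm b,
      add_comm b'] at h
    exact eq_of_shear_add_eq hmin ha₀ hb hb' h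

/-- A special edge has the value `t - 1 - s` on the support of `b`, and `1 ≤ s + 1 - t ≤ s < q j`.
For an edge that is not special, color `0` would make `a + b` constant, which is the special case `t
= s`. -/
lemma edgeColor_ne_zero {a b : ∀ i, ZMod (q i)} (ha₀ : a ≠ 0) (hb₀ : b ≠ 0)
    (hab : DisjSupp a b) : edgeColor i₀ a b ≠ 0 := by
  wlog hb : b i₀ = 0 generalizing a b
  · rw [edgeColor_comm]
    exact this hb₀ ha₀ hab.symm ((hab i₀).resolve_right hb)
  intro h
  have hs : ¬ Special i₀ b a := fun h => h.left_ne_zero hb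
  have hself : (a + b) i₀ = a i₀ := by simp [hb]
  have hself' : (a + (b - ind b)) i₀ = a i₀ := by simp [hb, ind_apply_of_eq_zero hb]
  by_cases h₁ : Special i₀ a b
  · rw [edgeColor_of_special h₁] at h
    obtain ⟨j, hj⟩ := exists_apply_ne_zero hb₀
    obtain ⟨t, ht₁, ht₂, h₃, h₄⟩ := h₁.exists_eq hmin
    have := congrFun h j
    simp only [shear, hself'] at this
    simp only [Pi.add_apply, Pi.sub_apply, ind_apply_of_ne_zero hj, h₄ j hj, Pi.zero_apply] at this
    have h5 : ((t : ℕ) : ZMod (q j)) = (((a i₀).val + 1 : ℕ) : ZMod (q j)) := by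
      push_cast
      linear_combination this
    have hlt := val_lt_of_le hmin a j
    have h6 := (ZMod.natCast_eq_natCast_iff' _ _ _).1 h5
    rw [Nat.mod_eq_of_lt (by omega)] at h6
    rcases (show (a i₀).val + 1 ≤ q j from hlt).lt_or_eq with h7 | h7
    · rw [Nat.mod_eq_of_lt h7] at h6; omega
    · rw [h7, Nat.mod_self] at h6; omega
  · rw [edgeColor_of_not_special h₁ hs] at h
    have hsum : ∀ j, a j + b j = ((a i₀).val : ZMod (q j)) := by
      intro j
      have := congrFun h j
      simp only [shear, hself] at this
      exact sub_eq_zero.1 this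
    by_cases ha : a i₀ = 0
    · apply ha₀
      funext j
      rcases hab j with hj | hj
      · exact hj
      · have := hsum j
        rw [hj, ha] at this
        simpa using this
    · refine h₁ ⟨(a i₀).val, ?_, le_rfl, fun j => ?_⟩
      · rw [Nat.one_le_iff_ne_zero, Ne, ZMod.val_eq_zero]
        exact ha
      · have := hsum j
        rcases hab j with hj | hj
        · exact Or.inr ⟨hj, by simpa [hj] using this⟩
        · exact Or.inl ⟨by simpa [hj] using this, hj⟩

end

end Shear

end IdealGraphs
namespace IdealGraphs

/-! ### The common combinatorial model, edge coloring and total coloring. -/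

section Model

variable {ι V : Type*} {q : ι → ℕ}

/-- `G` is the graph on the vectors `x v` in which two vectors are adjacent if they have disjoint
supports; every vector except `0` and a vector `p` of full support occurs exactly once. -/
structure IsSupportModel (G : SimpleGraph V) (x : V → ∀ i, ZMod (q i)) (p : ∀ i, ZMod (q i)) :
    Prop where
  injective : Function.Injective x
  exists_iff : ∀ z, (∃ v, x v = z) ↔ z ≠ 0 ∧ z ≠ p
  apply_ne_zero : ∀ i, p i ≠ 0
  adj_iff : ∀ v w, G.Adj v w ↔ DisjSupp (x v) (x w)

namespace IsSupportModel

variable {G : SimpleGraph V} {x : V → ∀ i, ZMod (q i)} {p : ∀ i, ZMod (q i)}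

lemma ne_zero (h : IsSupportModel G x p) (v : V) : x v ≠ 0 := ((h.exists_iff _).1 ⟨v, rfl⟩).1

lemma exists_of_apply_eq_zero (h : IsSupportModel G x p) {z : ∀ i, ZMod (q i)} (hz : z ≠ 0) {i : ι}
    (hi : z i = 0) : ∃ v, x v = z :=
  (h.exists_iff z).2 ⟨hz, fun h' => h.apply_ne_zero i (h' ▸ hi)⟩

/-- The colors: vectors with vanishing coordinate `i₀`. -/
def colors (q : ι → ℕ) (i₀ : ι) : Set (∀ i, ZMod (q i)) := {c | c i₀ = 0}

lemma one_ne_zero_zmod (h : IsSupportModel G x p) (i : ι) : (1 : ZMod (q i)) ≠ 0 := by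
  intro h1
  have := subsingleton_of_zero_eq_one h1.symm
  exact h.apply_ne_zero i (Subsingleton.elim _ _)

section

variable [Finite ι] [∀ i, NeZero (q i)] [Finite V]

omit [Finite ι] [∀ i, NeZero (q i)] in
-- The vertex with the single nonzero coordinate `i₀` is adjacent to every nonzero vector vanishing
-- there. If `i₀` is the only coordinate, that vertex may be missing, but then there are no colors.
lemma card_colors_diff_le (h : IsSupportModel G x p) (i₀ : ι) :
    Nat.card ↥(colors q i₀ \ {0}) ≤ maxDeg G := by
  classical
  by_cases hι : ∃ j, j ≠ i₀
  · obtain ⟨j, hj⟩ := hι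
    have h1 := h.one_ne_zero_zmod i₀
    obtain ⟨v, hv⟩ := h.exists_of_apply_eq_zero (z := Pi.single i₀ 1) (i := j)
      (fun h' => h1 (by simpa using congrFun h' i₀)) (by simp [hj])
    refine le_trans ?_ (card_neighborSet_le_maxDeg v)
    have hex : ∀ c : ↥(colors q i₀ \ {0}), ∃ w, x w = c := fun c =>
      h.exists_of_apply_eq_zero c.2.2 c.2.1
    choose g hg using hex
    refine Nat.card_le_card_of_injective (fun c => (⟨g c, ?_⟩ : G.neighborSet v)) ?_
    · rw [SimpleGraph.mem_neighborSet, h.adj_iff, hv, hg]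
      intro i
      by_cases hi : i = i₀
      · subst hi; exact Or.inr c.2.1
      · exact Or.inl (by simp [hi])
    · intro c c' hcc
      have hgg : g c = g c' := congrArg Subtype.val hcc
      exact Subtype.ext (by rw [← hg c, ← hg c', hgg])
  · push Not at hι
    have : IsEmpty ↥(colors q i₀ \ {0}) := ⟨fun c => c.2.2 (funext fun i => by
      rw [hι i]; exact c.2.1)⟩
    simp

omit [Finite V] in
lemma lineGraph_colorable_colors (h : IsSupportModel G x p) {i₀ : ι} (hmin : ∀ i, q i₀ ≤ q i) :
    G.lineGraph.Colorable (Nat.card ↥(colors q i₀ \ {0})) := by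
  refine lineGraph_colorable (colors q i₀ \ {0}) (fun v w => edgeColor i₀ (x v) (x w))
    (fun v w => edgeColor_comm _ _) (fun v w hvw => ?_) (fun v w w' hw hw' heq => ?_)
  · exact ⟨edgeColor_apply_self _ _,
      edgeColor_ne_zero hmin (h.ne_zero v) (h.ne_zero w) ((h.adj_iff _ _).1 hvw)⟩
  · exact h.injective (edgeColor_inj hmin (h.ne_zero v) (h.ne_zero w) (h.ne_zero w')
      ((h.adj_iff _ _).1 hw) ((h.adj_iff _ _).1 hw') heq)

/-- The edge chromatic number is the maximum degree. -/
theorem edgeChromaticNumber_eq [Nonempty ι] (h : IsSupportModel G x p) :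
    edgeChromaticNumber G = (maxDeg G : ℕ∞) := by
  obtain ⟨i₀, hmin⟩ := Finite.exists_min q
  exact edgeChromaticNumber_eq_maxDeg
    ((h.lineGraph_colorable_colors hmin).mono (h.card_colors_diff_le i₀))

theorem satisfiesTCC [Nonempty ι] [Nonempty V] (h : IsSupportModel G x p) : SatisfiesTCC G := by
  classical
  obtain ⟨i₀, hmin⟩ := Finite.exists_min q
  -- `none` is the extra color for the vertices satisfying `IsConst`; the others are the vectors
  -- vanishing at `i₀`, now with `0` included, whence `Δ + 2`.
  let P : Set (Option (∀ i, ZMod (q i))) := {o | ∀ c ∈ o, c i₀ = 0}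
  have hcard : Nat.card P ≤ Nat.card (Option (Option ↥(colors q i₀ \ {0}))) := by
    refine Nat.card_le_card_of_injective (fun o => match o with
      | ⟨none, _⟩ => none
      | ⟨some c, hc⟩ => if h : c = 0 then some none else some (some ⟨c, hc c rfl, h⟩)) ?_
    rintro ⟨_ | c, hc⟩ ⟨_ | c', hc'⟩ heq
    · rfl
    · by_cases h' : c' = 0 <;> simp [h'] at heq
    · by_cases h' : c = 0 <;> simp [h'] at heq
    · by_cases h₁ : c = 0 <;> by_cases h₂ : c' = 0 <;> simp [h₁, h₂] at heq ⊢
      exact congrArg Subtype.val heq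
  rw [Finite.card_option, Finite.card_option] at hcard
  refine satisfiesTCC_of_colorable (SimpleGraph.Colorable.mono
    (hcard.trans (Nat.add_le_add_right (h.card_colors_diff_le i₀) 2)) ?_)
  refine totalGraph_colorable P
    (fun v => if IsConst i₀ (x v) then none else some (shear i₀ (x v)))
    (fun v w => some (shear i₀ (x v + x w))) (fun v w => by rw [add_comm]) (fun v => ?_)
    (fun v w _ c hc => ?_) (fun v w hvw heq => ?_) (fun v w hvw heq => ?_)
    (fun v w w' hw hw' heq => ?_)
  · split_ifs
    · intro c hc; simp at hc
    · intro c hc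
      rw [← Option.some.inj hc]
      exact shear_apply_self _
  · rw [← Option.some.inj hc]
    exact shear_apply_self _
  · have hd := (h.adj_iff _ _).1 hvw
    by_cases h₁ : IsConst i₀ (x v) <;> by_cases h₂ : IsConst i₀ (x w)
    -- Two vertices with the extra color are both nonzero at `i₀`, hence not adjacent.
    · exact (hd i₀).elim h₁.1 h₂.1
    · simp [h₁, h₂] at heq
    · simp [h₁, h₂] at heq
    · simp only [h₁, h₂, if_false, Option.some.injEq] at heq
      exact (isConst_of_shear_eq (h.ne_zero v) hd heq).elim h₁ h₂
  · have hd := (h.adj_iff _ _).1 hvw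
    by_cases h₁ : IsConst i₀ (x v)
    · simp [h₁] at heq
    · simp only [h₁, if_false, Option.some.injEq] at heq
      -- The color of a vertex `v` is that of a fictitious edge to the zero vector, so it differs
      -- from those of the edges at `v`.
      refine h.ne_zero w (eq_of_shear_add_eq hmin (h.ne_zero v) (b' := 0) hd
        (fun i => Or.inr rfl) ?_)
      rw [← heq, add_zero]
  · exact h.injective (eq_of_shear_add_eq hmin (h.ne_zero v) ((h.adj_iff _ _).1 hw)
      ((h.adj_iff _ _).1 hw') (Option.some.inj heq))

omit [Finite ι] [∀ i, NeZero (q i)] [Finite V] in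
/-- If every vector of full support is `p`, then all coordinates lie in `{0, p i}`. -/
lemma apply_eq_of_forall_exists_eq_zero (h : IsSupportModel G x p) (hno : ∀ v, ∃ i, x v i = 0)
    {i : ι} {a : ZMod (q i)} (ha : a ≠ 0) : a = p i := by
  classical
  by_contra hne
  obtain ⟨v, hv⟩ := (h.exists_iff (Function.update p i a)).2
    ⟨fun h' => ha (by simpa using congrFun h' i), fun h' => hne (by simpa using congrFun h' i)⟩
  obtain ⟨j, hj⟩ := hno v
  rw [hv] at hj
  by_cases hji : j = i
  · subst hji; simp [ha] at hj
  · rw [Function.update_of_ne hji] at hj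
    exact h.apply_ne_zero j hj

omit [Finite ι] [∀ i, NeZero (q i)] in
/-- If no vertex has full support, then some vertex is adjacent to at most one other vertex. -/
lemma card_le_maxDeg_compl_add_two [Nonempty V] (h : IsSupportModel G x p)
    (hno : ∀ v, ∃ i, x v i = 0) : Nat.card V ≤ maxDeg Gᶜ + 2 := by
  classical
  obtain ⟨u⟩ := ‹Nonempty V›
  obtain ⟨i, hi⟩ := hno u
  obtain ⟨j, hj⟩ := exists_apply_ne_zero (h.ne_zero u)
  have hji : j ≠ i := fun h' => hj (h' ▸ hi)
  -- The support of `v` misses only `i`, so the only vector disjoint from it is `e`, supported at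
  -- `i`; all other vertices are neighbors of `v` in the complement.
  obtain ⟨v, hv⟩ := h.exists_of_apply_eq_zero (z := Function.update p i 0) (i := i)
    (fun h' => h.apply_ne_zero j (by simpa [hji] using congrFun h' j)) (by simp)
  obtain ⟨e, he⟩ := h.exists_of_apply_eq_zero (z := Pi.single i (p i)) (i := j)
    (fun h' => h.apply_ne_zero i (by simpa using congrFun h' i)) (by simp [hji])
  have hadj : ∀ w, w ≠ v → w ≠ e → Gᶜ.Adj v w := by
    intro w hwv hwe
    refine (SimpleGraph.compl_adj _ _ _).2 ⟨hwv.symm, fun hvw => hwe (h.injective ?_)⟩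
    have hd := (h.adj_iff _ _).1 hvw
    have hz : ∀ k, k ≠ i → x w k = 0 := fun k hk => (hd k).resolve_left (by
      rw [hv, Function.update_of_ne hk]; exact h.apply_ne_zero k)
    have hwi : x w i ≠ 0 := fun h0 => h.ne_zero w (funext fun k => by
      by_cases hk : k = i
      · subst hk; exact h0
      · exact hz k hk)
    rw [he]
    funext k
    by_cases hk : k = i
    · subst hk
      rw [Pi.single_eq_same]
      exact h.apply_eq_of_forall_exists_eq_zero hno hwi
    · rw [Pi.single_eq_of_ne hk, hz k hk]
  have hle : Nat.card V ≤ Nat.card (Option (Option (Gᶜ.neighborSet v))) := by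
    refine Nat.card_le_card_of_injective (fun w => if h₁ : w = v then none else
      if h₂ : w = e then some none else some (some ⟨w, hadj w h₁ h₂⟩)) ?_
    intro w w' heq
    by_cases h₁ : w = v <;> by_cases h₂ : w' = v <;> by_cases h₃ : w = e <;>
      by_cases h₄ : w' = e <;> simp only [h₁, h₂, h₃, h₄, dite_true, dite_false] at heq ⊢ <;>
      simp_all
    exact congrArg Subtype.val heq
  rw [Finite.card_option, Finite.card_option] at hle
  have := card_neighborSet_le_maxDeg (G := Gᶜ) v
  omega

omit [Finite ι] [∀ i, NeZero (q i)] in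
-- A vertex of full support is universal in the complement. Without one, each coordinate has a
-- single nonzero value `p i`, and addition is symmetric difference of supports: distinct sets that
-- meet have a symmetric difference that is neither empty nor everything.
theorem satisfiesTCC_compl [Nonempty V] (h : IsSupportModel G x p) : SatisfiesTCC Gᶜ := by
  apply satisfiesTCC_of_colorable
  by_cases hfull : ∃ v, ∀ i, x v i ≠ 0
  · obtain ⟨v, hv⟩ := hfull
    refine totalGraph_colorable_of_universal v fun w hwv =>
      (SimpleGraph.compl_adj _ _ _).2 ⟨hwv.symm, fun hvw => h.ne_zero w (funext fun i => ?_)⟩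
    exact ((h.adj_iff _ _).1 hvw i).resolve_left (hv i)
  · push Not at hfull
    have key : ∀ {i} {a : ZMod (q i)}, a ≠ 0 → a = p i := fun ha =>
      h.apply_eq_of_forall_exists_eq_zero hfull ha
    -- If `p i + p i` were nonzero it would be `p i`, forcing `p i = 0`.
    have hdouble : ∀ i, p i + p i = 0 := by
      intro i
      by_contra hne
      exact h.apply_ne_zero i (add_eq_left.1 (key hne))
    have hP : Nat.card (Set.range x) = Nat.card V :=
      Nat.card_congr (Equiv.ofInjective x h.injective).symm
    refine SimpleGraph.Colorable.mono (hP ▸ h.card_le_maxDeg_compl_add_two hfull) ?_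
    refine totalGraph_colorable_of_labelling _ x h.injective h.ne_zero (fun v => ⟨v, rfl⟩)
      (fun v w hvw => ?_)
    rw [SimpleGraph.compl_adj, h.adj_iff] at hvw
    refine (h.exists_iff _).2 ⟨fun h0 => hvw.1 (h.injective ?_), fun hp => hvw.2 fun i => ?_⟩
    · funext i
      have h0i : x v i + x w i = 0 := congrFun h0 i
      by_cases hv : x v i = 0
      · rw [hv, zero_add] at h0i; rw [hv, h0i]
      · by_cases hw : x w i = 0
        · rw [hw, add_zero] at h0i; exact absurd h0i hv
        · rw [key hv, key hw]
    · by_contra! hne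
      have hpi : x v i + x w i = p i := congrFun hp i
      rw [key hne.1, key hne.2, hdouble] at hpi
      exact h.apply_ne_zero i hpi.symm

end

end IsSupportModel

end Model

end IdealGraphs
namespace IdealGraphs

/-! ### Criteria for chordality. -/

section Chordal

variable {V : Type*} {G : SimpleGraph V}

lemma cycleGraph_adj_of_lt {k : ℕ} {a b : Fin k} (h : a < b) :
    (SimpleGraph.cycleGraph k).Adj a b ↔ b.val - a.val = 1 ∨ k + a.val - b.val = 1 := by
  rw [SimpleGraph.cycleGraph_adj', Fin.sub_val_of_le h.le, Fin.coe_sub_iff_lt.2 h]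
  exact or_comm

/-- An induced cycle of length at least `4` contains an induced path of length `3` whose first
vertex has a further neighbor on the cycle. -/
lemma isChordal_of_forall (h : ∀ a b c d e : V, G.Adj e a → G.Adj a b → G.Adj b c → G.Adj c d →
    a ≠ c → ¬ G.Adj a c → b ≠ d → ¬ G.Adj b d → e ≠ b → ¬ G.Adj e b → False) : IsChordal G := by
  rintro k hk ⟨f⟩
  let v : ∀ i, i < k → Fin k := fun i hi => ⟨i, hi⟩
  have hadj : ∀ i j (hi : i < k) (hj : j < k), i < j → (G.Adj (f (v i hi)) (f (v j hj)) ↔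
      j - i = 1 ∨ k + i - j = 1) := fun i j hi hj hij => by
    rw [f.map_adj_iff, cycleGraph_adj_of_lt (show v i hi < v j hj from hij)]
  have hne : ∀ i j (hi : i < k) (hj : j < k), i ≠ j → f (v i hi) ≠ f (v j hj) :=
    fun i j hi hj hij heq => hij (congrArg Fin.val (f.injective heq))
  -- The vertex numbered `k - 1` precedes `0` on the cycle; for `k = 4` it coincides with the vertex
  -- `3`.
  refine h (f (v 0 (by omega))) (f (v 1 (by omega))) (f (v 2 (by omega))) (f (v 3 (by omega)))
    (f (v (k - 1) (by omega))) (((hadj _ _ _ _ ?_).2 ?_).symm) ((hadj _ _ _ _ ?_).2 ?_)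
    ((hadj _ _ _ _ ?_).2 ?_) ((hadj _ _ _ _ ?_).2 ?_) (hne _ _ _ _ ?_)
    (fun h' => ?_) (hne _ _ _ _ ?_) (fun h' => ?_) (hne _ _ _ _ ?_) (fun h' => ?_)
  any_goals omega
  · have := (hadj _ _ _ _ (by omega)).1 h'; omega
  · have := (hadj _ _ _ _ (by omega)).1 h'; omega
  · have := (hadj _ _ _ _ (by omega)).1 h'.symm; omega

/-- An induced cycle of length `4` is an obstruction to chordality. -/
lemma not_isChordal_of_four (a b c d : V) (hab : G.Adj a b) (hbc : G.Adj b c) (hcd : G.Adj c d)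
    (hda : G.Adj d a) (hac : a ≠ c) (hac' : ¬ G.Adj a c) (hbd : b ≠ d) (hbd' : ¬ G.Adj b d) :
    ¬ IsChordal G := by
  have hadj : ∀ i j : Fin 4, G.Adj (![a, b, c, d] i) (![a, b, c, d] j) ↔
      (SimpleGraph.cycleGraph 4).Adj i j := by
    have h₁ : ¬ G.Adj c a := fun h => hac' h.symm
    have h₂ : ¬ G.Adj d b := fun h => hbd' h.symm
    have h₃ := hab.symm
    have h₄ := hbc.symm
    have h₅ := hcd.symm
    have h₆ := hda.symm
    intro i j
    rw [SimpleGraph.cycleGraph_adj']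
    fin_cases i <;> fin_cases j <;> first
      | exact iff_of_true (by assumption) (by decide)
      | exact iff_of_false (by assumption) (by decide)
      | exact iff_of_false (G.irrefl) (by decide)
  intro h
  refine h 4 le_rfl ⟨⟨⟨![a, b, c, d], ?_⟩, hadj _ _⟩⟩
  intro i j hij
  have := hab.ne; have := hbc.ne; have := hcd.ne; have := hda.ne
  fin_cases i <;> fin_cases j <;> simp_all

end Chordal

/-! ### Perfection of disjointness graphs on four points. -/

section Perfect

variable {V : Type*} {G : SimpleGraph V}

/-- The pentagon has no triangle but needs three colors. -/
lemma not_isPerfect_of_cycleGraph_five [Finite V]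
    (h : (SimpleGraph.cycleGraph 5).IsIndContained G) : ¬ IsPerfect G := by
  classical
  obtain ⟨f⟩ := h
  intro hG
  let g : SimpleGraph.cycleGraph 5 ↪g G.induce (Set.range f) :=
    ⟨⟨fun i => ⟨f i, i, rfl⟩, fun i j hij => f.injective (congrArg Subtype.val hij)⟩,
      f.map_adj_iff⟩
  have hχ := hG (Set.range f)
  have hclique : (G.induce (Set.range f)).cliqueNum ≤ 2 := by
    by_contra! hlt
    obtain ⟨s, hs⟩ := (G.induce (Set.range f)).exists_isNClique_cliqueNum
    obtain ⟨t, hts, ht⟩ := Finset.exists_subset_card_eq (s := s) (n := 3) (by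
      rw [hs.card_eq]; exact hlt)
    obtain ⟨a, b, c, hab, hac, hbc, rfl⟩ := Finset.card_eq_three.1 ht
    obtain ⟨⟨_, i, rfl⟩, ⟨_, j, rfl⟩, ⟨_, k, rfl⟩⟩ := a, b, c
    have h₁ : (SimpleGraph.cycleGraph 5).Adj i j :=
      f.map_adj_iff.1 (hs.isClique (hts (by simp)) (hts (by simp)) hab)
    have h₂ : (SimpleGraph.cycleGraph 5).Adj i k :=
      f.map_adj_iff.1 (hs.isClique (hts (by simp)) (hts (by simp)) hac)
    have h₃ : (SimpleGraph.cycleGraph 5).Adj j k :=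
      f.map_adj_iff.1 (hs.isClique (hts (by simp)) (hts (by simp)) hbc)
    clear hbc hac hab hts ht
    revert i j k
    simp only [SimpleGraph.cycleGraph_adj']
    decide
  have hcol : (G.induce (Set.range f)).Colorable 2 :=
    SimpleGraph.chromaticNumber_le_iff_colorable.1 (by rw [hχ]; exact_mod_cast hclique)
  have h5 := SimpleGraph.chromaticNumber_le_iff_colorable.2 (hcol.of_hom g.toHom)
  rw [SimpleGraph.chromaticNumber_cycleGraph_of_odd 5 (by norm_num)
    (by decide)] at h5
  exact absurd h5 (by decide)

lemma le_cliqueNum_of_pairwise [Finite V] {k : ℕ} (f : Fin k → V)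
    (h : ∀ i j, i ≠ j → G.Adj (f i) (f j)) : k ≤ G.cliqueNum := by
  classical
  have hf : Function.Injective f := fun i j hij => by
    by_contra hne
    exact (h i j hne).ne hij
  have hc : G.IsClique (Finset.univ.image f : Finset V) := by
    intro v hv w hw hvw
    simp only [Finset.coe_image, Finset.coe_univ, Set.image_univ, Set.mem_range] at hv hw
    obtain ⟨⟨i, rfl⟩, ⟨j, rfl⟩⟩ := hv, hw
    exact h i j fun hij => hvw (congrArg f hij)
  have := SimpleGraph.IsClique.card_le_cliqueNum (tc := hc)
  rwa [Finset.card_image_of_injective _ hf, Finset.card_univ, Fintype.card_fin] at this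

/-- Choosing an element of each set is a proper coloring, and the clique number says how few
elements suffice. Below `4`, some singleton `{d}` does not occur, and elements other than `d` can be
chosen. Below `3`, some point `a` lies in an end of every edge, and membership of `a` is a
`2`-coloring. Below `2` there are no edges. -/
lemma colorable_cliqueNum [Finite V] (A : V → Finset (Fin 4)) (hne : ∀ v, (A v).Nonempty)
    (hadj : ∀ v w, G.Adj v w ↔ Disjoint (A v) (A w)) : G.Colorable G.cliqueNum := by
  classical
  have hmem : ∀ {v w : V} {a : Fin 4}, G.Adj v w → a ∈ A v → a ∉ A w := fun h ha =>
    Finset.disjoint_left.1 ((hadj _ _).1 h) ha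
  rcases isEmpty_or_nonempty V with hV | ⟨⟨v₀⟩⟩
  · exact SimpleGraph.Colorable.of_isEmpty _
  by_cases h4 : 4 ≤ G.cliqueNum
  · refine SimpleGraph.Colorable.mono h4 ⟨SimpleGraph.Coloring.mk (fun v => (A v).min' (hne v)) ?_⟩
    intro v w hvw heq
    exact hmem hvw (Finset.min'_mem _ (hne v)) (heq ▸ Finset.min'_mem _ (hne w))
  have hsing : ∃ d, ∀ v, A v ≠ {d} := by
    by_contra! hall
    choose f hf using hall
    exact h4 (le_cliqueNum_of_pairwise f fun i j hij => by
      rw [hadj, hf, hf]; simpa using hij)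
  by_cases h3 : 3 ≤ G.cliqueNum
  · obtain ⟨d, hd⟩ := hsing
    have hex : ∀ v, ∃ a : {a : Fin 4 // a ≠ d}, a.1 ∈ A v := by
      intro v
      by_contra! hno
      refine hd v (Finset.eq_singleton_iff_nonempty_unique_mem.2 ⟨hne v, fun a ha => ?_⟩)
      by_contra had
      exact hno ⟨a, had⟩ ha
    choose c hc using hex
    have hcol : G.Colorable (Fintype.card {a : Fin 4 // a ≠ d}) :=
      (SimpleGraph.Coloring.mk c fun {v w} hvw heq =>
        hmem hvw (hc v) (heq ▸ hc w)).colorable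
    refine hcol.mono (le_trans ?_ h3)
    simp [Fintype.card_subtype_compl]
  by_cases h2 : 2 ≤ G.cliqueNum
  · suffices h : ∃ a, ∀ v w, G.Adj v w → a ∈ A v ∨ a ∈ A w by
      obtain ⟨a, ha⟩ := h
      refine SimpleGraph.Colorable.mono h2
        (SimpleGraph.Coloring.mk (fun v => decide (a ∈ A v)) ?_ : G.Coloring Bool).colorable
      intro v w hvw heq
      have heq' : a ∈ A v ↔ a ∈ A w := by simpa using heq
      rcases ha v w hvw with h | h
      · exact hmem hvw h (heq'.1 h)
      · exact hmem hvw (heq'.2 h) h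
    -- If singletons `{a}` and `{b}` occur, a set avoiding both would complete a triangle, so all
    -- sets avoiding `a` contain `b`. Otherwise at most one singleton `{a}` occurs, and disjoint
    -- sets avoiding `a` would be two sets of size at least `2` within three points.
    by_cases htwo : ∃ v w, ∃ a b : Fin 4, a ≠ b ∧ A v = {a} ∧ A w = {b}
    · obtain ⟨u, u', a, b, hab, hu, hu'⟩ := htwo
      refine ⟨a, fun v w hvw => ?_⟩
      by_contra! hno
      have hb : ∀ y, a ∉ A y → b ∈ A y := by
        intro y hy
        by_contra hby
        apply h3
        have h₁ : G.Adj u u' := by rw [hadj, hu, hu']; simpa using hab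
        have h₂ : G.Adj u y := by rw [hadj, hu]; simpa using hy
        have h₃ : G.Adj u' y := by rw [hadj, hu']; simpa using hby
        refine le_cliqueNum_of_pairwise ![u, u', y] fun i j hij => ?_
        fin_cases i <;> fin_cases j <;> first
          | exact absurd rfl hij
          | simp [h₁, h₂, h₃, h₁.symm, h₂.symm, h₃.symm]
      exact hmem hvw (hb v hno.1) (hb w hno.2)
    · push Not at htwo
      have hex : ∃ a, ∀ v b, b ≠ a → A v ≠ {b} := by
        by_cases h1 : ∃ u a, A u = {a}
        · obtain ⟨u, a, hu⟩ := h1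
          exact ⟨a, fun v b hba hv => htwo u v a b hba.symm hu hv⟩
        · push Not at h1
          exact ⟨0, fun v b _ => h1 v b⟩
      obtain ⟨a, ha⟩ := hex
      refine ⟨a, fun v w hvw => ?_⟩
      by_contra! hno
      have hcard : ∀ y, a ∉ A y → 2 ≤ (A y).card := by
        intro y hy
        by_contra! hlt
        have h1 : (A y).card = 1 := by have := (hne y).card_pos; omega
        obtain ⟨b, hb⟩ := Finset.card_eq_one.1 h1
        exact ha y b (fun h => hy (by simp [hb, h])) hb
      have hsub : A v ∪ A w ⊆ Finset.univ.erase a := by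
        intro b hb
        refine Finset.mem_erase.2 ⟨?_, Finset.mem_univ _⟩
        rintro rfl
        exact (Finset.mem_union.1 hb).elim hno.1 hno.2
      have hle := Finset.card_le_card hsub
      rw [Finset.card_union_of_disjoint ((hadj _ _).1 hvw), Finset.card_erase_of_mem
        (Finset.mem_univ _), Finset.card_univ, Fintype.card_fin] at hle
      have := hcard v hno.1
      have := hcard w hno.2
      omega
  · have h1 : 1 ≤ G.cliqueNum := le_cliqueNum_of_pairwise (fun _ : Fin 1 => v₀) fun i j hij =>
      absurd (Subsingleton.elim i j) hij
    refine SimpleGraph.Colorable.mono h1 ⟨SimpleGraph.Coloring.mk (fun _ => 0) ?_⟩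
    intro v w hvw _
    refine h2 (le_cliqueNum_of_pairwise ![v, w] fun i j hij => ?_)
    fin_cases i <;> fin_cases j <;> first
      | exact absurd rfl hij
      | simp [hvw, hvw.symm]

/-- Disjointness graphs of nonempty subsets of a set with at most four elements are perfect. -/
lemma isPerfect_of_disjoint [Finite V] (A : V → Finset (Fin 4)) (hne : ∀ v, (A v).Nonempty)
    (hadj : ∀ v w, G.Adj v w ↔ Disjoint (A v) (A w)) : IsPerfect G := by
  intro s
  refine le_antisymm (SimpleGraph.chromaticNumber_le_iff_colorable.2 ?_)
    SimpleGraph.cliqueNum_le_chromaticNumber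
  exact colorable_cliqueNum (fun v => A v.1) (fun v => hne v.1) fun v w => hadj v.1 w.1

end Perfect

end IdealGraphs
namespace IdealGraphs

/-! ### Chordality and perfection of the model. -/

section Model

variable {n : ℕ} {V : Type*} {q : Fin n → ℕ} {G : SimpleGraph V}
  {x : V → ∀ i, ZMod (q i)} {p : ∀ i, ZMod (q i)}

lemma eq_of_ne_zero_of_eq_two {m : ℕ} (hm : m = 2) {a b : ZMod m} (ha : a ≠ 0) (hb : b ≠ 0) :
    a = b := by
  subst hm
  revert a b
  decide

namespace IsSupportModel

lemma two_le (h : IsSupportModel G x p) [∀ i, NeZero (q i)] (i : Fin n) : 2 ≤ q i := by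
  by_contra! hlt
  have h0 := NeZero.ne (q i)
  have h1 : q i = 1 := by omega
  have : Subsingleton (ZMod (q i)) := by rw [h1]; infer_instance
  exact h.apply_ne_zero i (Subsingleton.elim _ _)

lemma exists_ne_zero_ne_one (h : IsSupportModel G x p) [∀ i, NeZero (q i)] {i : Fin n}
    (hi : q i ≠ 2) : ∃ a : ZMod (q i), a ≠ 0 ∧ 1 ≠ a := by
  have := h.two_le i
  have hlt : 2 < q i := by omega
  refine ⟨((2 : ℕ) : ZMod (q i)), fun h0 => ?_, fun h1 => ?_⟩
  · have := natCast_inj_of_lt (m := q i) (a := 2) (b := 0) hlt (by omega) (by simpa using h0)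
    omega
  · have := natCast_inj_of_lt (m := q i) (a := 1) (b := 2) (by omega) hlt (by simpa using h1)
    omega

/-- Vertices with prescribed supports. -/
lemma exists_vertices (h : IsSupportModel G x p) {r k : ℕ} (hr : r ≤ n)
    (S : Fin k → Finset (Fin r)) (hS : Function.Injective S) (hne : ∀ i, (S i).Nonempty)
    (huniv : ∀ i, ∃ a, a ∉ S i) :
    ∃ f : Fin k → V, Function.Injective f ∧
      ∀ i j, G.Adj (f i) (f j) ↔ Disjoint (S i) (S j) := by
  classical
  let z : Fin k → ∀ i, ZMod (q i) := fun a i =>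
    if i ∈ (S a).map (Fin.castLEEmb hr) then 1 else 0
  have hz : ∀ a i, z a i ≠ 0 ↔ i ∈ (S a).map (Fin.castLEEmb hr) := fun a i => by
    have := h.one_ne_zero_zmod i
    by_cases hi : i ∈ (S a).map (Fin.castLEEmb hr) <;> simp only [z, hi, if_true, if_false] <;>
      simp [this]
  have hex : ∀ a, ∃ v, x v = z a := by
    intro a
    obtain ⟨b, hb⟩ := hne a
    obtain ⟨c, hc⟩ := huniv a
    refine h.exists_of_apply_eq_zero (i := Fin.castLEEmb hr c) (fun h0 => ?_) ?_
    · exact (hz a (Fin.castLEEmb hr b)).2 (Finset.mem_map_of_mem _ hb) (congrFun h0 _)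
    · by_contra hne
      exact hc ((Finset.mem_map' _).1 ((hz _ _).1 hne))
  choose f hf using hex
  refine ⟨f, fun a b hab => hS (Finset.map_injective (Fin.castLEEmb hr) ?_), fun a b => ?_⟩
  · ext i
    rw [← hz, ← hz, ← hf, ← hf, hab]
  · rw [h.adj_iff, hf, hf, ← Finset.disjoint_map (Fin.castLEEmb hr), Finset.disjoint_left]
    refine forall_congr' fun i => ?_
    rw [← hz, ← hz]
    tauto

/-- Each of the four vectors is disjoint from a nonzero one, so it has a zero coordinate and is not
the excluded vector `p`. -/
lemma not_isChordal_of_vectors (h : IsSupportModel G x p) {a b c d : ∀ i, ZMod (q i)}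
    (ha : a ≠ 0) (hb : b ≠ 0) (hc : c ≠ 0) (hd : d ≠ 0) (hab : DisjSupp a b) (hbc : DisjSupp b c)
    (hcd : DisjSupp c d) (hda : DisjSupp d a) (hac : a ≠ c) (hac' : ¬ DisjSupp a c) (hbd : b ≠ d)
    (hbd' : ¬ DisjSupp b d) : ¬ IsChordal G := by
  have key : ∀ {y z : ∀ i, ZMod (q i)}, y ≠ 0 → z ≠ 0 → DisjSupp y z → ∃ v, x v = z := by
    intro y z hy hz hyz
    obtain ⟨i, hi⟩ := exists_apply_ne_zero hy
    exact h.exists_of_apply_eq_zero hz ((hyz i).resolve_left hi)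
  obtain ⟨u, rfl⟩ := key hd ha hda
  obtain ⟨v, rfl⟩ := key ha hb hab
  obtain ⟨w, rfl⟩ := key hb hc hbc
  obtain ⟨y, rfl⟩ := key hc hd hcd
  refine not_isChordal_of_four u v w y ?_ ?_ ?_ ?_ (fun h => hac (h ▸ rfl)) ?_
    (fun h => hbd (h ▸ rfl)) ?_ <;> rwa [h.adj_iff]

lemma not_isChordal_of_four_le (h : IsSupportModel G x p) (hn : 4 ≤ n) : ¬ IsChordal G := by
  obtain ⟨f, hf, hadj⟩ := h.exists_vertices hn
    -- Consecutive sets are disjoint, and the opposite ones meet in `0` and in `2`.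
    (![{0}, {2}, {0, 1}, {2, 3}] : Fin 4 → Finset (Fin 4)) (by decide) (by decide) (by decide)
  refine not_isChordal_of_four (f 0) (f 1) (f 2) (f 3) ?_ ?_ ?_ ?_ (hf.ne (by decide)) ?_
    (hf.ne (by decide)) ?_ <;> rw [hadj] <;> decide

lemma not_isChordal_compl_of_four_le (h : IsSupportModel G x p) (hn : 4 ≤ n) :
    ¬ IsChordal Gᶜ := by
  obtain ⟨f, hf, hadj⟩ := h.exists_vertices hn
    (![{0, 1}, {1, 2}, {2, 3}, {3, 0}] : Fin 4 → Finset (Fin 4)) (by decide) (by decide)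
    (by decide)
  refine not_isChordal_of_four (f 0) (f 1) (f 2) (f 3) ?_ ?_ ?_ ?_ (hf.ne (by decide)) ?_
    (hf.ne (by decide)) ?_ <;> rw [SimpleGraph.compl_adj, hadj, hf.ne_iff] <;> decide

/-- The edges `e a`, `a b`, `b c`, `c d` each give a coordinate shared by their ends. These four
coordinates are distinct, because a coincidence would give a common point to `a, c`, to `b, d` or to
`e, b`. -/
lemma isChordal_compl (h : IsSupportModel G x p) (hn : n ≤ 3) : IsChordal Gᶜ := by
  have hmeet : ∀ {v w : V}, Gᶜ.Adj v w → ∃ i, x v i ≠ 0 ∧ x w i ≠ 0 := by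
    intro v w hvw
    rw [SimpleGraph.compl_adj, h.adj_iff] at hvw
    simpa [DisjSupp] using hvw.2
  have hdisj : ∀ {v w : V}, v ≠ w → ¬ Gᶜ.Adj v w → DisjSupp (x v) (x w) := by
    intro v w hne hvw
    rw [← h.adj_iff]
    by_contra hG
    exact hvw ((SimpleGraph.compl_adj _ _ _).2 ⟨hne, hG⟩)
  refine isChordal_of_forall fun a b c d e hea hab hbc hcd hac hac' hbd hbd' heb heb' => ?_
  obtain ⟨i, hie, hia⟩ := hmeet hea
  obtain ⟨j, hja, hjb⟩ := hmeet hab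
  obtain ⟨k, hkb, hkc⟩ := hmeet hbc
  obtain ⟨l, hlc, hld⟩ := hmeet hcd
  have hac := hdisj hac hac'
  have hbd := hdisj hbd hbd'
  have heb := hdisj heb heb'
  have h₁ : i ≠ j := by rintro rfl; exact (heb i).elim hie hjb
  have h₂ : i ≠ k := by rintro rfl; exact (hac i).elim hia hkc
  have h₃ : i ≠ l := by rintro rfl; exact (hac i).elim hia hlc
  have h₄ : j ≠ k := by rintro rfl; exact (hac j).elim hja hkc
  have h₅ : j ≠ l := by rintro rfl; exact (hac j).elim hja hlc
  have h₆ : k ≠ l := by rintro rfl; exact (hbd k).elim hkb hld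
  omega

theorem isChordal_compl_iff (h : IsSupportModel G x p) : IsChordal Gᶜ ↔ n ≤ 3 := by
  refine ⟨fun hG => ?_, h.isChordal_compl⟩
  by_contra! hn
  exact h.not_isChordal_compl_of_four_le hn hG

theorem isPerfect_iff [Finite V] (h : IsSupportModel G x p) : IsPerfect G ↔ n ≤ 4 := by
  classical
  constructor
  · intro hG
    by_contra! hn
    obtain ⟨f, hf, hadj⟩ := h.exists_vertices (show 5 ≤ n from hn)
      -- The sides of a pentagon, every second one in turn: consecutive ones are disjoint, all
      -- others share a corner.
      (![{0, 1}, {2, 3}, {4, 0}, {1, 2}, {3, 4}] : Fin 5 → Finset (Fin 5)) (by decide) (by decide)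
      (by decide)
    refine not_isPerfect_of_cycleGraph_five ⟨⟨⟨f, hf⟩, fun {i j} => (hadj i j).trans ?_⟩⟩ hG
    rw [SimpleGraph.cycleGraph_adj']
    revert i j
    decide
  · intro hn
    let A : V → Finset (Fin n) := fun v => Finset.univ.filter fun i => x v i ≠ 0
    refine isPerfect_of_disjoint (fun v => (A v).map (Fin.castLEEmb hn)) (fun v => ?_)
      (fun v w => ?_)
    · obtain ⟨i, hi⟩ := exists_apply_ne_zero (h.ne_zero v)
      exact Finset.Nonempty.map ⟨i, by simpa [A] using hi⟩
    · rw [h.adj_iff, Finset.disjoint_map, Finset.disjoint_left]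
      refine forall_congr' fun i => ?_
      simp only [A, Finset.mem_filter, Finset.mem_univ, true_and]
      tauto

lemma isChordal_of_eq_one (h : IsSupportModel G x p) (hn : n = 1) : IsChordal G := by
  subst hn
  refine isChordal_of_forall fun a b c d e _ hab _ _ _ _ _ _ _ _ => ?_
  rcases (h.adj_iff _ _).1 hab 0 with h0 | h0
  · exact h.ne_zero a (funext fun i => Subsingleton.elim 0 i ▸ h0)
  · exact h.ne_zero b (funext fun i => Subsingleton.elim 0 i ▸ h0)

lemma isChordal_of_eq_two (h : IsSupportModel G x p) (hn : n = 2) {i : Fin n} (hi : q i = 2) :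
    IsChordal G := by
  obtain ⟨j, hj⟩ : ∃ j : Fin n, j ≠ i := by
    have : Nontrivial (Fin n) := by rw [hn]; infer_instance
    exact exists_ne i
  have hcases : ∀ k, k = i ∨ k = j := fun k => by omega
  have hnz : ∀ v, x v i = 0 → x v j ≠ 0 := fun v hv hv' => h.ne_zero v (funext fun k => by
    rcases hcases k with rfl | rfl
    · exact hv
    · exact hv')
  -- Here `b` is supported on `j` alone, so `a` and `c` are supported on `i` alone, where only one
  -- nonzero value exists.
  have key : ∀ a b c, G.Adj a b → G.Adj b c → x a i ≠ 0 → a = c := by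
    intro a b c hab hbc ha
    rw [h.adj_iff] at hab hbc
    have hbj := hnz b ((hab i).resolve_left ha)
    have haj := (hab j).resolve_right hbj
    have hcj := (hbc j).resolve_left hbj
    have hci : x c i ≠ 0 := fun h0 => hnz c h0 hcj
    refine h.injective (funext fun k => ?_)
    rcases hcases k with rfl | rfl
    · exact eq_of_ne_zero_of_eq_two hi ha hci
    · rw [haj, hcj]
  refine isChordal_of_forall fun a b c d e _ hab hbc hcd hac _ hbd _ _ _ => ?_
  by_cases ha : x a i = 0
  · refine hbd (key b c d hbc hcd fun hb => ?_)
    exact ((h.adj_iff _ _).1 hab j).elim (hnz a ha) (hnz b hb)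
  · exact hac (key a b c hab hbc ha)

lemma isChordal_of_eq_three (h : IsSupportModel G x p) (hn : n = 3) (hq : ∀ i, q i = 2) :
    IsChordal G := by
  have hmeet : ∀ {v w : V}, ¬ G.Adj v w → ∃ i, x v i ≠ 0 ∧ x w i ≠ 0 := by
    intro v w hvw
    rw [h.adj_iff] at hvw
    simpa [DisjSupp] using hvw
  -- A vertex with two distinct nonadjacent neighbors has a singleton support: two points in it
  -- would leave only one for both neighbors, which would then coincide. Applied to `a` and `c`,
  -- which share a coordinate, this gives `a = c`.
  have key : ∀ {u v w}, G.Adj u v → G.Adj u w → v ≠ w → ¬ G.Adj v w →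
      ∀ {i j}, x u i ≠ 0 → x u j ≠ 0 → i = j := by
    intro u v w huv huw hvw hvw' i j hi hj
    by_contra hij
    obtain ⟨l, hvl, hwl⟩ := hmeet hvw'
    rw [h.adj_iff] at huv huw
    refine hvw (h.injective (funext fun k => ?_))
    by_cases hk : x u k = 0
    · have hl : x u l = 0 := (huv l).resolve_right hvl
      have hli : l ≠ i := by rintro rfl; exact hi hl
      have hlj : l ≠ j := by rintro rfl; exact hj hl
      have hki : k ≠ i := by rintro rfl; exact hi hk
      have hkj : k ≠ j := by rintro rfl; exact hj hk
      obtain rfl : k = l := by omega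
      exact eq_of_ne_zero_of_eq_two (hq k) hvl hwl
    · rw [(huv k).resolve_left hk, (huw k).resolve_left hk]
  refine isChordal_of_forall fun a b c d e hea hab hbc hcd hac hac' hbd hbd' heb heb' => ?_
  obtain ⟨l, hal, hcl⟩ := hmeet hac'
  refine hac (h.injective (funext fun k => ?_))
  by_cases hk : k = l
  · subst hk
    exact eq_of_ne_zero_of_eq_two (hq k) hal hcl
  · have ha : x a k = 0 := by
      by_contra hne
      exact hk (key hea.symm hab heb heb' hne hal)
    have hc : x c k = 0 := by
      by_contra hne
      exact hk (key hbc.symm hcd hbd hbd' hne hcl)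
    rw [ha, hc]

/-- Two nonzero values in each coordinate give two vectors on each axis, and these form an induced
4-cycle. -/
lemma not_isChordal_of_eq_two [∀ i, NeZero (q i)] (h : IsSupportModel G x p) (hn : n = 2)
    (hq : ∀ i, q i ≠ 2) : ¬ IsChordal G := by
  obtain ⟨i, j, hij⟩ : ∃ i j : Fin n, i ≠ j := by
    have : Nontrivial (Fin n) := by rw [hn]; infer_instance
    exact exists_pair_ne _
  obtain ⟨a, ha, ha'⟩ := h.exists_ne_zero_ne_one (hq i)
  obtain ⟨b, hb, hb'⟩ := h.exists_ne_zero_ne_one (hq j)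
  have hi := h.one_ne_zero_zmod i
  have hj := h.one_ne_zero_zmod j
  have hd : ∀ {i j : Fin n} (a : ZMod (q i)) (b : ZMod (q j)), i ≠ j →
      DisjSupp (Pi.single (M := fun i => ZMod (q i)) i a) (Pi.single j b) := by
    intro i j a b hij k
    by_cases hk : k = i
    · subst hk; exact Or.inr (Pi.single_eq_of_ne hij _)
    · exact Or.inl (Pi.single_eq_of_ne hk _)
  have hd' : ∀ {i : Fin n} {a b : ZMod (q i)}, a ≠ 0 → b ≠ 0 →
      ¬ DisjSupp (Pi.single (M := fun i => ZMod (q i)) i a) (Pi.single i b) := by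
    intro i a b ha hb h
    have := h i
    rw [Pi.single_eq_same, Pi.single_eq_same] at this
    exact this.elim ha hb
  have hz : ∀ {i : Fin n} {a : ZMod (q i)}, a ≠ 0 →
      (Pi.single i a : ∀ i, ZMod (q i)) ≠ 0 := fun ha => by
    rwa [Ne, Pi.single_eq_zero_iff]
  exact h.not_isChordal_of_vectors (hz hi) (hz hj) (hz ha) (hz hb) (hd _ _ hij) (hd _ _ hij.symm)
    (hd _ _ hij) (hd _ _ hij.symm) ((Pi.single_injective i).ne ha') (hd' hi ha)
    ((Pi.single_injective j).ne hb') (hd' hj hb)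

/-- Two vectors supported at `i` with different values are opposite corners of a 4-cycle; the other
two have supports `{j}` and `{j, k}`. -/
lemma not_isChordal_of_eq_three [∀ i, NeZero (q i)] (h : IsSupportModel G x p) (hn : n = 3)
    {i : Fin n} (hq : q i ≠ 2) : ¬ IsChordal G := by
  obtain ⟨j, k, hji, hki, hjk⟩ : ∃ j k : Fin n, j ≠ i ∧ k ≠ i ∧ j ≠ k := by
    subst hn
    revert i
    intro i _
    clear * -
    revert i
    decide
  obtain ⟨a, ha, ha'⟩ := h.exists_ne_zero_ne_one hq
  have hi := h.one_ne_zero_zmod i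
  have hj := h.one_ne_zero_zmod j
  have hk := h.one_ne_zero_zmod k
  let b : ∀ i, ZMod (q i) := Pi.single j 1
  let d : ∀ i, ZMod (q i) := Pi.single j 1 + Pi.single k 1
  have hbi : b i = 0 := Pi.single_eq_of_ne hji.symm _
  have hdi : d i = 0 := by
    change (Pi.single j 1 : ∀ i, ZMod (q i)) i + (Pi.single k 1 : ∀ i, ZMod (q i)) i = (0 : ZMod (q i))
    rw [Pi.single_eq_of_ne hji.symm, Pi.single_eq_of_ne hki.symm, add_zero]
  have hbj : b j = 1 := Pi.single_eq_same _ _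
  have hdj : d j = 1 := by
    change (Pi.single j 1 : ∀ i, ZMod (q i)) j + (Pi.single k 1 : ∀ i, ZMod (q i)) j = (1 : ZMod (q j))
    rw [Pi.single_eq_same, Pi.single_eq_of_ne hjk, add_zero]
  have hs : ∀ {a : ZMod (q i)}, a ≠ 0 → (Pi.single i a : ∀ i, ZMod (q i)) ≠ 0 := fun ha => by
    rwa [Ne, Pi.single_eq_zero_iff]
  have hd : ∀ (a : ZMod (q i)) (y : ∀ i, ZMod (q i)), y i = 0 → DisjSupp (Pi.single i a) y := by
    intro a y hy l
    by_cases hl : l = i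
    · subst hl; exact Or.inr hy
    · exact Or.inl (Pi.single_eq_of_ne hl _)
  refine h.not_isChordal_of_vectors (hs hi) (b := b) (fun h0 => hj ?_) (hs ha) (d := d)
    (fun h0 => hj ?_) (hd _ _ hbi) (hd _ _ hbi).symm (hd _ _ hdi) (hd _ _ hdi).symm
    ((Pi.single_injective i).ne ha') (fun h0 => ?_) (fun h0 => hk ?_) (fun h0 => ?_)
  · rw [← hbj, h0]; rfl
  · rw [← hdj, h0]; rfl
  · have := h0 i
    rw [Pi.single_eq_same, Pi.single_eq_same] at this
    exact this.elim hi ha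
  · have : (Pi.single k 1 : ∀ i, ZMod (q i)) = 0 := left_eq_add.1 h0
    rwa [Pi.single_eq_zero_iff] at this
  · have := h0 j
    rw [hbj, hdj] at this
    exact this.elim hj hj

theorem isChordal_iff [∀ i, NeZero (q i)] (h : IsSupportModel G x p) (hn : 1 ≤ n) :
    IsChordal G ↔ n = 1 ∨ (n = 2 ∧ ∃ i, q i = 2) ∨ (n = 3 ∧ ∀ i, q i = 2) := by
  constructor
  · intro hG
    have h4 : n < 4 := not_le.1 fun h4 => h.not_isChordal_of_four_le h4 hG
    rcases (by omega : n = 1 ∨ n = 2 ∨ n = 3) with h1 | h2 | h3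
    · exact Or.inl h1
    · refine Or.inr (Or.inl ⟨h2, ?_⟩)
      by_contra! hq
      exact h.not_isChordal_of_eq_two h2 hq hG
    · refine Or.inr (Or.inr ⟨h3, fun i => ?_⟩)
      by_contra hq
      exact h.not_isChordal_of_eq_three h3 hq hG
  · rintro (h1 | ⟨h2, i, hi⟩ | ⟨h3, hq⟩)
    · exact h.isChordal_of_eq_one h1
    · exact h.isChordal_of_eq_two h2 hi
    · exact h.isChordal_of_eq_three h3 hq

end IsSupportModel

end Model

end IdealGraphs
namespace IdealGraphs

/-! ### Ideals of Artinian local rings. -/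

section LocalRings

variable {A : Type*} [CommRing A] [IsLocalRing A]

open IsLocalRing

lemma sup_eq_top_iff_of_isLocalRing (I J : Ideal A) : I ⊔ J = ⊤ ↔ I = ⊤ ∨ J = ⊤ := by
  refine ⟨fun h => ?_, ?_⟩
  · by_contra! hne
    exact (maximalIdeal.isMaximal A).ne_top
      (top_le_iff.1 (h ▸ sup_le (le_maximalIdeal hne.1) (le_maximalIdeal hne.2)))
  · rintro (rfl | rfl) <;> simp

lemma isNilpotent_maximalIdeal [IsArtinianRing A] : IsNilpotent (maximalIdeal A) := by
  rw [← jacobson_eq_maximalIdeal ⊥ bot_ne_top]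
  exact IsArtinianRing.isNilpotent_jacobson_bot

/-- The maximal ideal of an Artinian local ring is annihilated by a nonzero element. -/
lemma exists_ne_zero_forall_mul_eq_zero [IsArtinianRing A] :
    ∃ r : A, r ≠ 0 ∧ ∀ y ∈ maximalIdeal A, r * y = 0 := by
  classical
  have hnil : ∃ k, maximalIdeal A ^ k = 0 := isNilpotent_maximalIdeal
  have hk := Nat.find_spec hnil
  obtain ⟨k, hk'⟩ : ∃ k, Nat.find hnil = k + 1 := Nat.exists_eq_succ_of_ne_zero fun h0 => by
    rw [h0, pow_zero, Ideal.one_eq_top] at hk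
    exact top_ne_bot hk
  -- Any nonzero element of the last nonzero power of the maximal ideal will do.
  have hne : maximalIdeal A ^ k ≠ ⊥ := Nat.find_min hnil (by omega)
  obtain ⟨r, hr, hr0⟩ := Submodule.exists_mem_ne_zero_of_ne_bot hne
  refine ⟨r, hr0, fun y hy => ?_⟩
  have := Ideal.mul_mem_mul hr hy
  rw [← pow_succ, ← hk', hk] at this
  simpa using this

/-- Nonzero ideals of an Artinian local principal ideal ring meet nontrivially. -/
lemma inf_eq_bot_iff_of_isPrincipalIdealRing [IsArtinianRing A] [IsPrincipalIdealRing A]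
    (I J : Ideal A) : I ⊓ J = ⊥ ↔ I = ⊥ ∨ J = ⊥ := by
  classical
  obtain ⟨ϖ, hϖ⟩ := IsPrincipalIdealRing.principal (maximalIdeal A)
  rw [Ideal.submodule_span_eq] at hϖ
  have hnil : ∃ k, ϖ ^ k = 0 := by
    obtain ⟨k, hk⟩ := isNilpotent_maximalIdeal (A := A)
    refine ⟨k, ?_⟩
    rw [hϖ, Ideal.span_singleton_pow] at hk
    exact Ideal.span_singleton_eq_bot.1 hk
  obtain ⟨K, hK⟩ : ∃ K, Nat.find hnil = K + 1 := Nat.exists_eq_succ_of_ne_zero fun h0 => by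
    have := Nat.find_spec hnil
    rw [h0, pow_zero] at this
    exact one_ne_zero this
  have hK0 : ϖ ^ (K + 1) = 0 := hK ▸ Nat.find_spec hnil
  have hKne : ϖ ^ K ≠ 0 := Nat.find_min hnil (by omega)
  -- A nonzero element is a unit times a power of `ϖ`, so every nonzero ideal contains the last
  -- nonzero power `ϖ ^ K`.
  have key : ∀ I : Ideal A, I ≠ ⊥ → ϖ ^ K ∈ I := by
    intro I hI
    obtain ⟨y, hy, hy0⟩ := Submodule.exists_mem_ne_zero_of_ne_bot hI
    have hex : ∃ k, ¬ ϖ ^ k ∣ y := ⟨K + 1, fun h => hy0 (zero_dvd_iff.1 (hK0 ▸ h))⟩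
    obtain ⟨k, hk⟩ : ∃ k, Nat.find hex = k + 1 := Nat.exists_eq_succ_of_ne_zero fun h0 => by
      have := Nat.find_spec hex
      rw [h0, pow_zero] at this
      exact this (one_dvd y)
    have hdvd : ϖ ^ k ∣ y := not_not.1 (Nat.find_min hex (m := k) (by omega))
    have hndvd : ¬ ϖ ^ (k + 1) ∣ y := hk ▸ Nat.find_spec hex
    obtain ⟨u, rfl⟩ := hdvd
    have hu : IsUnit u := by
      by_contra hu
      have hmem : u ∈ maximalIdeal A := hu
      rw [hϖ, Ideal.mem_span_singleton] at hmem
      exact hndvd (pow_succ ϖ k ▸ mul_dvd_mul_left _ hmem)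
    have hkK : k ≤ K := by
      by_contra! hlt
      apply hy0
      rw [show k = K + 1 + (k - (K + 1)) by omega, pow_add, hK0]
      simp
    rw [Ideal.mul_unit_mem_iff_mem _ hu] at hy
    rw [show K = k + (K - k) by omega, pow_add]
    exact I.mul_mem_right _ hy
  refine ⟨fun h => ?_, ?_⟩
  · by_contra! hne
    have : ϖ ^ K ∈ I ⊓ J := ⟨key I hne.1, key J hne.2⟩
    rw [h] at this
    exact hKne (by simpa using this)
  · rintro (rfl | rfl) <;> simp

omit [IsLocalRing A] in
lemma isField_iff_card_ideal_eq_two : IsField A ↔ Nat.card (Ideal A) = 2 := by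
  rw [Ring.isField_iff_isSimpleOrder_ideal]
  constructor
  · intro h
    classical
    have := Fintype.ofEquiv _ (IsSimpleOrder.equivBool (α := Ideal A)).symm
    rw [Nat.card_congr (IsSimpleOrder.equivBool (α := Ideal A))]
    simp
  · intro h
    obtain ⟨I, J, hIJ, hun⟩ := Nat.card_eq_two_iff.1 h
    have hmem : ∀ K : Ideal A, K = I ∨ K = J := fun K => by
      have : K ∈ ({I, J} : Set (Ideal A)) := hun ▸ Set.mem_univ K
      simpa using this
    have hne : (⊥ : Ideal A) ≠ ⊤ := by
      intro hbt
      have hs : Subsingleton (Ideal A) := subsingleton_of_bot_eq_top hbt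
      exact hIJ (Subsingleton.elim _ _)
    refine { exists_pair_ne := ⟨⊥, ⊤, hne⟩, eq_bot_or_eq_top := fun K => ?_ }
    rcases hmem K with hK | hK <;> rcases hmem ⊥ with hb | hb <;> rcases hmem ⊤ with ht | ht
    all_goals first
      | exact Or.inl (hK.trans hb.symm)
      | exact Or.inr (hK.trans ht.symm)
      | exact absurd (hb.trans ht.symm) hne

end LocalRings

/-! ### Ideals of products, the support models and the comparison of the graphs. -/

section Products

variable {n : ℕ} {R : Fin n → Type*} [∀ i, CommRing (R i)]

/-- The components of an ideal of the product. -/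
noncomputable def comp (I : Ideal (∀ i, R i)) : ∀ i, Ideal (R i) := Ideal.piOrderIso I

lemma comp_sup (I J : Ideal (∀ i, R i)) (i : Fin n) : comp (I ⊔ J) i = comp I i ⊔ comp J i := by
  simp only [comp, map_sup, Pi.sup_apply]

lemma comp_inf (I J : Ideal (∀ i, R i)) (i : Fin n) : comp (I ⊓ J) i = comp I i ⊓ comp J i := by
  simp only [comp, map_inf, Pi.inf_apply]

lemma eq_top_iff_comp (I : Ideal (∀ i, R i)) : I = ⊤ ↔ ∀ i, comp I i = ⊤ := by
  rw [← map_eq_top_iff (Ideal.piOrderIso (R := R))]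
  exact funext_iff

lemma eq_bot_iff_comp (I : Ideal (∀ i, R i)) : I = ⊥ ↔ ∀ i, comp I i = ⊥ := by
  rw [← map_eq_bot_iff (Ideal.piOrderIso (R := R))]
  exact funext_iff

lemma apply_mem_comp {I : Ideal (∀ i, R i)} {y : ∀ i, R i} (hy : y ∈ I) (i : Fin n) :
    y i ∈ comp I i :=
  Ideal.mem_map_of_mem (Pi.evalRingHom R i) hy

lemma isAnnihilatingIdeal_iff {A : Type*} [CommRing A] (I : Ideal A) :
    IsAnnihilatingIdeal I ↔ I.annihilator ≠ ⊥ := by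
  rw [Submodule.ne_bot_iff]
  refine exists_congr fun r => ?_
  rw [Submodule.mem_annihilator, and_comm]
  rfl

variable [∀ i, IsLocalRing (R i)]

/-- Some component of a proper ideal lies in the maximal ideal of its factor, which is killed by a
nonzero element; finiteness of the set of ideals makes the factor Artinian. Put that element in this
coordinate and `0` elsewhere. -/
lemma isAnnihilatingIdeal_iff_ne_top [∀ i, Finite (Ideal (R i))] (I : Ideal (∀ i, R i)) :
    IsAnnihilatingIdeal I ↔ I ≠ ⊤ := by
  classical
  constructor
  · rintro ⟨r, hr, h⟩ rfl
    exact hr (by simpa using h 1 trivial)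
  · intro hI
    rw [Ne, eq_top_iff_comp] at hI
    push Not at hI
    obtain ⟨i, hi⟩ := hI
    have : IsArtinianRing (R i) := ⟨(Finite.to_wellFoundedLT (α := Ideal (R i))).wf⟩
    obtain ⟨r, hr, h⟩ := exists_ne_zero_forall_mul_eq_zero (A := R i)
    refine ⟨Pi.single i r, by rwa [Ne, Pi.single_eq_zero_iff], fun y hy => ?_⟩
    funext j
    by_cases hj : j = i
    · subst hj
      simpa using h _ (IsLocalRing.le_maximalIdeal hi (apply_mem_comp hy j))
    · simp [hj]

lemma exists_equiv_apply_eq {α β : Type*} [Finite α] (h : Nat.card α = Nat.card β) [Finite β]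
    (a : α) (b : β) : ∃ e : α ≃ β, e a = b := by
  classical
  obtain ⟨e⟩ := Finite.card_eq.1 h
  exact ⟨e.trans (Equiv.swap (e a) b), by simp⟩

omit [∀ i, IsLocalRing (R i)] in
/-- Graphs on the ideals of a product in which adjacency is decided by the components equal to
the given bound `a` of the lattices of ideals have a support model. -/
lemma exists_isSupportModel [∀ i, Finite (Ideal (R i))] {G : SimpleGraph (Vertex (∀ i, R i))}
    (a b : ∀ i, Ideal (R i)) (hab : ∀ i, b i ≠ a i)
    (hvert : ∀ I : Ideal (∀ i, R i), (I ≠ ⊥ ∧ I ≠ ⊤) ↔ comp I ≠ a ∧ comp I ≠ b)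
    (hadj : ∀ I J, G.Adj I J ↔ ∀ i, comp I.1 i = a i ∨ comp J.1 i = a i) :
    ∃ (x : Vertex (∀ i, R i) → ∀ i, ZMod (Nat.card (Ideal (R i)))) (p : _),
      IsSupportModel G x p := by
  have hex : ∀ i, ∃ e : Ideal (R i) ≃ ZMod (Nat.card (Ideal (R i))), e (a i) = 0 := fun i => by
    have : NeZero (Nat.card (Ideal (R i))) := ⟨Nat.card_ne_zero.2 ⟨⟨⊥⟩, inferInstance⟩⟩
    exact exists_equiv_apply_eq (Nat.card_zmod _).symm _ _
  choose e he using hex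
  let E : Ideal (∀ i, R i) ≃ ∀ i, ZMod (Nat.card (Ideal (R i))) :=
    (Ideal.piOrderIso (R := R)).toEquiv.trans (Equiv.piCongrRight e)
  have hE : ∀ I i, E I i = e i (comp I i) := fun I i => rfl
  have hEz : ∀ I i, E I i = 0 ↔ comp I i = a i := fun I i => by
    rw [hE, ← he i, (e i).apply_eq_iff_eq]
  refine ⟨fun I => E I.1, fun i => e i (b i), ⟨fun I J h => Subtype.ext (E.injective h), fun z => ?_,
    fun i h => ?_, fun I J => ?_⟩⟩
  · obtain ⟨I, rfl⟩ := E.surjective z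
    have h₁ : E I = 0 ↔ comp I = a := by
      rw [funext_iff, funext_iff]
      exact forall_congr' fun i => hEz I i
    have h₂ : (E I = fun i => e i (b i)) ↔ comp I = b := by
      rw [funext_iff, funext_iff]
      exact forall_congr' fun i => by rw [hE, (e i).apply_eq_iff_eq]
    rw [Ne, Ne, h₁, h₂, ← Ne, ← Ne, ← hvert]
    refine ⟨?_, fun h => ⟨⟨I, h⟩, rfl⟩⟩
    rintro ⟨J, hJ⟩
    rw [← E.injective hJ]
    exact J.2
  · rw [← he i, (e i).apply_eq_iff_eq] at h
    exact hab i h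
  · rw [hadj]
    exact forall_congr' fun i => by rw [hEz, hEz]

lemma exists_isSupportModel_CG [∀ i, Finite (Ideal (R i))] :
    ∃ (x : Vertex (∀ i, R i) → ∀ i, ZMod (Nat.card (Ideal (R i)))) (p : _),
      IsSupportModel (CG (∀ i, R i)) x p := by
  refine exists_isSupportModel (fun _ => ⊤) (fun _ => ⊥) (fun _ => bot_ne_top) (fun I => ?_)
    (fun I J => ?_)
  · rw [Ne, Ne, eq_bot_iff_comp, eq_top_iff_comp, Ne, Ne, funext_iff, funext_iff, and_comm]
  · change (I ≠ J ∧ I.1 ⊔ J.1 = ⊤) ↔ _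
    rw [eq_top_iff_comp]
    simp only [comp_sup, sup_eq_top_iff_of_isLocalRing]
    refine and_iff_right_of_imp fun h hIJ => J.2.2 ?_
    subst hIJ
    rw [eq_top_iff_comp]
    exact fun i => (h i).elim id id

/-- The roles of the zero and unit ideals are exchanged: an ideal vanishes in the model where its
component is zero. -/
lemma exists_isSupportModel_compl_IG [∀ i, Finite (Ideal (R i))]
    (hR : ∀ i, IsArtinianRing (R i) ∧ IsPrincipalIdealRing (R i)) :
    ∃ (x : Vertex (∀ i, R i) → ∀ i, ZMod (Nat.card (Ideal (R i)))) (p : _),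
      IsSupportModel (IG (∀ i, R i))ᶜ x p := by
  have := fun i => (hR i).1
  have := fun i => (hR i).2
  refine exists_isSupportModel (fun _ => ⊥) (fun _ => ⊤) (fun _ => top_ne_bot) (fun I => ?_)
    (fun I J => ?_)
  · rw [Ne, Ne, eq_bot_iff_comp, eq_top_iff_comp, Ne, Ne, funext_iff, funext_iff]
  · rw [SimpleGraph.compl_adj]
    change (I ≠ J ∧ ¬ (I ≠ J ∧ I.1 ⊓ J.1 ≠ ⊥)) ↔ _
    have h : I.1 ⊓ J.1 = ⊥ ↔ ∀ i, comp I.1 i = ⊥ ∨ comp J.1 i = ⊥ := by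
      rw [eq_bot_iff_comp]
      simp only [comp_inf, inf_eq_bot_iff_of_isPrincipalIdealRing]
    rw [← h]
    constructor
    · rintro ⟨hne, h'⟩
      by_contra hbot
      exact h' ⟨hne, hbot⟩
    · refine fun hbot => ⟨fun hIJ => ?_, fun h' => h'.2 hbot⟩
      subst hIJ
      exact I.2.1 (by simpa using hbot)

omit [∀ i, IsLocalRing (R i)] in
/-- The properties of a graph on the ideals of a product which follow from a support model. -/
theorem IsSupportModel.properties [∀ i, Finite (Ideal (R i))] (hn : 1 ≤ n)
    {G : SimpleGraph (Vertex (∀ i, R i))}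
    {x : Vertex (∀ i, R i) → ∀ i, ZMod (Nat.card (Ideal (R i)))}
    {p : ∀ i, ZMod (Nat.card (Ideal (R i)))} (h : IsSupportModel G x p) :
    (IsChordal G ↔ n = 1 ∨ (n = 2 ∧ ∃ i, IsField (R i)) ∨ (n = 3 ∧ ∀ i, IsField (R i))) ∧
      (IsChordal Gᶜ ↔ n ≤ 3) ∧ (IsPerfect G ↔ n ≤ 4) ∧
      (Nonempty (Vertex (∀ i, R i)) → SatisfiesTCC G ∧ SatisfiesTCC Gᶜ) ∧
      edgeChromaticNumber G = (maxDeg G : ℕ∞) := by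
  have : ∀ i, NeZero (Nat.card (Ideal (R i))) := fun i =>
    ⟨Nat.card_ne_zero.2 ⟨⟨⊥⟩, inferInstance⟩⟩
  have : Nonempty (Fin n) := ⟨⟨0, hn⟩⟩
  refine ⟨?_, h.isChordal_compl_iff, h.isPerfect_iff,
    fun _ => ⟨h.satisfiesTCC, h.satisfiesTCC_compl⟩, h.edgeChromaticNumber_eq⟩
  simp only [isField_iff_card_ideal_eq_two]
  exact h.isChordal_iff hn

lemma CG_eq_CAG [∀ i, Finite (Ideal (R i))] : CG (∀ i, R i) = CAG (∀ i, R i) := by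
  ext I J
  change (I ≠ J ∧ I.1 ⊔ J.1 = ⊤) ↔ (I ≠ J ∧ I.1.annihilator ⊓ J.1.annihilator = ⊥)
  rw [← Submodule.annihilator_sup]
  refine and_congr_right fun _ => ?_
  rw [← not_iff_not, ← Ne, ← isAnnihilatingIdeal_iff_ne_top, isAnnihilatingIdeal_iff]

lemma CG_eq_compl_AG [∀ i, Finite (Ideal (R i))] : CG (∀ i, R i) = (AG (∀ i, R i))ᶜ := by
  ext I J
  rw [SimpleGraph.compl_adj]
  change (I ≠ J ∧ I.1 ⊔ J.1 = ⊤) ↔ (I ≠ J ∧ ¬ (I ≠ J ∧ IsAnnihilatingIdeal (I.1 ⊔ J.1)))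
  rw [isAnnihilatingIdeal_iff_ne_top]
  tauto

end Products

end IdealGraphs

open IdealGraphs in
theorem corollary1p3 {n : ℕ} (hn : 1 ≤ n) (R : Fin n → Type*) [∀ i, CommRing (R i)]
    [∀ i, IsLocalRing (R i)] [∀ i, Finite (Ideal (R i))] :
    -- (A) the graphs coincide, and so do their complements
    (CG (∀ i, R i) = CAG (∀ i, R i) ∧ CAG (∀ i, R i) = (AG (∀ i, R i))ᶜ ∧
      (CG (∀ i, R i))ᶜ = (CAG (∀ i, R i))ᶜ ∧ (CAG (∀ i, R i))ᶜ = AG (∀ i, R i)) ∧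
    -- (B), (C), (D), (E) for each of the three graphs
    (∀ G ∈ ({CG (∀ i, R i), CAG (∀ i, R i), (AG (∀ i, R i))ᶜ} : Set (SimpleGraph _)),
      (IsChordal G ↔
        n = 1 ∨ (n = 2 ∧ ∃ i, IsField (R i)) ∨ (n = 3 ∧ ∀ i, IsField (R i))) ∧
      (IsChordal Gᶜ ↔ n ≤ 3) ∧
      (IsPerfect G ↔ n ≤ 4) ∧
      (Nonempty (Vertex (∀ i, R i)) → SatisfiesTCC G ∧ SatisfiesTCC Gᶜ) ∧
      edgeChromaticNumber G = (maxDeg G : ℕ∞)) ∧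
    -- (F) the same for the complement of the intersection graph of ideals
    ((∀ i, IsArtinianRing (R i) ∧ IsPrincipalIdealRing (R i)) →
      (IsChordal (IG (∀ i, R i))ᶜ ↔
        n = 1 ∨ (n = 2 ∧ ∃ i, IsField (R i)) ∨ (n = 3 ∧ ∀ i, IsField (R i))) ∧
      (IsChordal (IG (∀ i, R i)) ↔ n ≤ 3) ∧
      (IsPerfect (IG (∀ i, R i))ᶜ ↔ n ≤ 4) ∧
      (Nonempty (Vertex (∀ i, R i)) →
        SatisfiesTCC (IG (∀ i, R i))ᶜ ∧ SatisfiesTCC (IG (∀ i, R i))) ∧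
      edgeChromaticNumber (IG (∀ i, R i))ᶜ = (maxDeg (IG (∀ i, R i))ᶜ : ℕ∞)) := by
  have hCAG : CAG (∀ i, R i) = CG (∀ i, R i) := CG_eq_CAG.symm
  have hAG : (AG (∀ i, R i))ᶜ = CG (∀ i, R i) := CG_eq_compl_AG.symm
  refine ⟨⟨hCAG.symm, hCAG.trans hAG.symm, by rw [hCAG], by rw [hCAG, ← hAG, compl_compl]⟩,
    fun G hG => ?_, fun hR => ?_⟩
  · obtain ⟨x, p, h⟩ := exists_isSupportModel_CG (R := R)
    obtain rfl : G = CG (∀ i, R i) := by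
      rw [hCAG, hAG] at hG
      simpa using hG
    exact h.properties hn
  · obtain ⟨x, p, h⟩ := exists_isSupportModel_compl_IG hR
    have := h.properties hn
    rwa [compl_compl] at this
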